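/- A $k$-graph $(\Lambda,d)$ is a countable small category $\Lambda$ with a functor $d:\Lambda\to\mathbb N^k$ such that whenever $d(\lambda)=m+n$ there are unique $\mu,\sigma\in\Lambda$ with $d(\mu)=m$, $d(\sigma)=n$ and $\lambda=\mu\sigma$. Write $r,s$ for the codomain and domain maps, identify the objects with $\Lambda^0=d^{-1}(0)$, and for a vertex $v$ put $v\Lambda=\{\lambda: r(\lambda)=v\}$ and $\Lambda v=\{\lambda : s(\lambda)=v\}$. For $\lambda,\mu\in\Lambda$ let $\Lambda^{\min}(\lambda,\mu)$ be the set of pairs $(\alpha,\beta)$ with $\lambda\alpha=\mu\beta$ and $d(\lambda\alpha)=d(\lambda)\vee d(\mu)$; $\Lambda$ is finitely aligned if all these sets are finite. A set $E\subseteq v\Lambda$ is exhaustive if for every $\mu\in v\Lambda$ there is $\lambda\in E$ with $\Lambda^{\min}(\lambda,\mu)\neq\emptyset$. For finitely aligned $\Lambda$, a Cuntz–Krieger $\Lambda$-family is a family $\{t_\lambda:\lambda\in\Lambda\}$ of partial isometries in a $C^*$-algebra such that (i) the $t_v$, $v\in\Lambda^0$, are mutually orthogonal projections; (ii) $t_\lambda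 t_\mu=t_{\lambda\mu}$ if $s(\lambda)=r(\mu)$; (iii) $t_\lambda^*t_\mu=\sum_{(\alpha,\beta)\in\Lambda^{\min}(\lambda,\mu)}t_\alpha t_\beta^*$ for all $\lambda,\mu$; (iv) $\prod_{\lambda\in E}(t_v-t_\lambda t_\lambda^*)=0$ for every $v\in\Lambda^0$ and every finite exhaustive $E\subseteq v\Lambda$. Let $C^*(\Lambda)$ be the universal $C^*$-algebra generated by a Cuntz–Krieger $\Lambda$-family $\{s_\lambda\}$. For $m\in(\mathbb N\cup\{\infty\})^k$ let $\Omega_{k,m}$ be the $k$-graph with objects $\{p\in\mathbb N^k:p\le m\}$ and one morphism $(p,q)$, with range $p$, source $q$ and degree $q-p$, for each pair of objects $p\le q$. A boundary path is a degree-preserving functor $x:\Omega_{k,m}\to\Lambda$, for some $m$, such that there is $n_x\in\mathbb N^k$ with $n_x\le m$ for which $n\in\mathbb N^k$, $n_x\le n\le m$ and $n_i=m_i$ imply that no path of degree $e_i$ has range $x(n)$. Put $r(x)=x(0)$. For $\lambda\in\Lambda$ with $s(\lambda)=r(x)$ let $\lambda x:\Omega_{k,m+d(\lambda)}\to\Lambda$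 be the unique degree-preserving functor with $(\lambda x)(0,d(\lambda))=\lambda$ and $(\lambda x)(d(\lambda),n)=x(0,n-d(\lambda))$ for all $n \in \mathbb N^k$ with $d(\lambda)\le n\le m+d(\lambda)$. **Theorem 4.5.** Let $(\Lambda,d)$ be a finitely aligned $k$-graph such that (B) for each $v\in\Lambda^0$ there is a boundary path $x$ with $r(x)=v$ such that $\lambda x\neq\mu x$ for all $\lambda,\mu\in\Lambda v$ with $\lambda\neq\mu$. If $\pi$ is a $*$-homomorphism from $C^*(\Lambda)$ to a $C^*$-algebra with $\pi(s_v)\neq0$ for all $v\in\Lambda^0$, then $\pi$ is injective. -/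

import Mathlib

open CategoryTheory
open scoped ENNReal

universe u v w

/-- A `k`-graph: a countable small category with a degree functor to `ℕ^k` that satisfies the
factorisation property. A morphism `f : a ⟶ b` is a path with source `a` and range `b`; the
composite written `μσ` (first `σ`, then `μ`) is `σ ≫ μ` in Mathlib's notation. -/
structure KGraph (k : ℕ) where
  /-- The objects (vertices). -/
  Obj : Type u
  [cat : SmallCategory Obj]
  /-- The set of all morphisms (hence also the set of objects) is countable. -/
  countable : Countable (Σ a b : Obj, a ⟶ b)
  /-- The degree functor. -/
  deg : ∀ {a b : Obj}, (a ⟶ b) → (Fin k → ℕ)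
  deg_id : ∀ a : Obj, deg (𝟙 a) = 0
  deg_comp : ∀ {a b c : Obj} (f : a ⟶ b) (g : b ⟶ c), deg (f ≫ g) = deg g + deg f
  /-- If `d(f) = m + n` there are unique `μ, σ` with `d(μ) = m`, `d(σ) = n` and `f = μσ`. -/
  factor : ∀ {a b : Obj} (f : a ⟶ b) (m n : Fin k → ℕ), deg f = m + n →
    ∃! p : Σ c : Obj, (a ⟶ c) × (c ⟶ b),
      deg p.2.2 = m ∧ deg p.2.1 = n ∧ p.2.1 ≫ p.2.2 = f

namespace KGraph

attribute [instance] KGraph.cat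

/-- The paths of `Λ`: morphisms together with their source and range. -/
@[ext]
structure Path {k : ℕ} (Λ : KGraph.{u} k) where
  /-- The source (domain). -/
  src : Λ.Obj
  /-- The range (codomain). -/
  rng : Λ.Obj
  /-- The underlying morphism. -/
  hom : src ⟶ rng

namespace Path

variable {k : ℕ} {Λ : KGraph.{u} k}

/-- The degree of a path. -/
def deg (μ : Λ.Path) : Fin k → ℕ := Λ.deg μ.hom

/-- The composite path `μν`, defined when `s(μ) = r(ν)`. -/
def comp (μ ν : Λ.Path) (h : μ.src = ν.rng) : Λ.Path :=
  ⟨ν.src, μ.rng, ν.hom ≫ eqToHom h.symm ≫ μ.hom⟩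

end Path

section Basic

variable {k : ℕ} (Λ : KGraph.{u} k)

/-- The vertex `v`, regarded as a path of degree `0`. -/
def vertex (v : Λ.Obj) : Λ.Path := ⟨v, v, 𝟙 v⟩

/-- The pairs `(α, β)` with `μα = νβ` and `d(μα) = d(μ) ∨ d(ν)`. -/
def Lmin (μ ν : Λ.Path) : Set (Λ.Path × Λ.Path) :=
  {p | ∃ (h₁ : μ.src = p.1.rng) (h₂ : ν.src = p.2.rng),
    μ.comp p.1 h₁ = ν.comp p.2 h₂ ∧ (μ.comp p.1 h₁).deg = μ.deg ⊔ ν.deg}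

/-- `Λ` is finitely aligned if every `Λmin(μ, ν)` is finite. -/
def FinitelyAligned : Prop := ∀ μ ν : Λ.Path, (Λ.Lmin μ ν).Finite

/-- `E ⊆ vΛ` is exhaustive: every `μ ∈ vΛ` has a common extension with some element of `E`. -/
def Exhaustive (v : Λ.Obj) (E : Set Λ.Path) : Prop :=
  (∀ ν ∈ E, ν.rng = v) ∧ ∀ μ : Λ.Path, μ.rng = v → ∃ ν ∈ E, (Λ.Lmin ν μ).Nonempty

/-- Cuntz-Krieger `Λ`-families in a (possibly non-unital) C*-algebra, for finitely aligned `Λ`.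
In the last relation a finite subset `E` of `vΛ` is given by a list without repetitions. All
factors `t_v - t_μ t_μ^*` of the product lie in the corner `t_v A t_v`, whose unit is `t_v`, and
the product is formed there; that is, the empty product is `t_v`. (An exhaustive set is never
empty, so that starting the product with `t_v` does not change its value.) -/
structure IsCuntzKrieger {A : Type v} [NonUnitalCStarAlgebra A] (t : Λ.Path → A) : Prop where
  partial_isometry : ∀ μ, t μ * star (t μ) * t μ = t μ
  vertex_projection : ∀ v, IsStarProjection (t (Λ.vertex v))
  vertex_orthogonal : ∀ v w, v ≠ w → t (Λ.vertex v) * t (Λ.vertex w) = 0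
  mul_eq : ∀ (μ ν : Λ.Path) (h : μ.src = ν.rng), t μ * t ν = t (μ.comp ν h)
  star_mul_eq : ∀ μ ν : Λ.Path,
    star (t μ) * t ν = ∑ᶠ (p : Λ.Path × Λ.Path) (_ : p ∈ Λ.Lmin μ ν), t p.1 * star (t p.2)
  prod_eq_zero : ∀ (v : Λ.Obj) (E : List Λ.Path), E.Nodup → Λ.Exhaustive v {μ | μ ∈ E} →
    E.foldr (fun μ a => (t (Λ.vertex v) - t μ * star (t μ)) * a) (t (Λ.vertex v)) = 0

end Basic

/-! ### The universal C*-algebra -/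

section Universal

variable {k : ℕ} (Λ : KGraph.{u} k)

/-- A Cuntz-Krieger `Λ`-family in some C*-algebra. -/
structure CKFamily where
  /-- The C*-algebra in which the family lives. -/
  Alg : Type w
  [inst : NonUnitalCStarAlgebra Alg]
  /-- The members of the family. -/
  elt : Λ.Path → Alg
  isCK : Λ.IsCuntzKrieger elt

attribute [instance] CKFamily.inst

variable {Λ} in
theorem IsCuntzKrieger.norm_le_one {A : Type v} [NonUnitalCStarAlgebra A] {t : Λ.Path → A}
    (ht : Λ.IsCuntzKrieger t) (μ : Λ.Path) : ‖t μ‖ ≤ 1 := by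
  have h1 : star (t μ) * t μ * (star (t μ) * t μ) = star (t μ) * t μ := by
    rw [mul_assoc, ← mul_assoc (t μ), ht.partial_isometry]
  have h2 : ‖star (t μ) * t μ * (star (t μ) * t μ)‖ =
      ‖star (t μ) * t μ‖ * ‖star (t μ) * t μ‖ := by
    conv_lhs =>
      rw [show star (t μ) * t μ * (star (t μ) * t μ) =
        star (star (t μ) * t μ) * (star (t μ) * t μ) by simp [star_mul]]
    exact CStarRing.norm_star_mul_self
  rw [h1, CStarRing.norm_star_mul_self] at h2
  have h3 := norm_nonneg (t μ)
  by_contra! h4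
  have h5 : 1 < ‖t μ‖ * ‖t μ‖ := by nlinarith
  nlinarith

/-- The direct sum of all Cuntz-Krieger `Λ`-families, in the C*-algebra of bounded elements of the
product of their C*-algebras. -/
noncomputable def sumFamily (μ : Λ.Path) : lp (fun i : CKFamily.{u, w} Λ => i.Alg) ∞ :=
  ⟨fun i => i.elt μ, memℓp_infty ⟨1, by
    rintro _ ⟨i, rfl⟩
    exact i.isCK.norm_le_one μ⟩⟩

/-- The C*-subalgebra generated by the direct sum of all Cuntz-Krieger `Λ`-families. -/
noncomputable def cstarSubalgebra :
    NonUnitalStarSubalgebra ℂ (lp (fun i : CKFamily.{u, w} Λ => i.Alg) ∞) :=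
  (NonUnitalStarAlgebra.adjoin ℂ (Set.range (sumFamily.{u, w} Λ))).topologicalClosure

/-- `C*(Λ)`, the universal C*-algebra generated by a Cuntz-Krieger `Λ`-family. -/
abbrev CStar : Type (max u (w + 1)) := ↥(cstarSubalgebra.{u, w} Λ)

noncomputable instance : NonUnitalCStarAlgebra (CStar.{u, w} Λ) :=
  NonUnitalStarSubalgebra.nonUnitalCStarAlgebra _
    (h_closed := NonUnitalStarSubalgebra.isClosed_topologicalClosure _)

/-- The generating family `s_μ` of `C*(Λ)`. -/
noncomputable def gen (μ : Λ.Path) : CStar.{u, w} Λ :=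
  ⟨sumFamily.{u, w} Λ μ, NonUnitalStarSubalgebra.le_topologicalClosure _
    (NonUnitalStarAlgebra.subset_adjoin ℂ _ ⟨μ, rfl⟩)⟩

variable {Λ}

theorem finsum_apply_lp (hΛ : Λ.FinitelyAligned) (μ ν : Λ.Path)
    (f : Λ.Path × Λ.Path → lp (fun i : CKFamily.{u, w} Λ => i.Alg) ∞) (i : CKFamily.{u, w} Λ) :
    (∑ᶠ (p : Λ.Path × Λ.Path) (_ : p ∈ Λ.Lmin μ ν), f p : lp _ ∞) i =
      ∑ᶠ (p : Λ.Path × Λ.Path) (_ : p ∈ Λ.Lmin μ ν), f p i := by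
  rw [finsum_mem_eq_finite_toFinset_sum _ (hΛ μ ν), finsum_mem_eq_finite_toFinset_sum _ (hΛ μ ν)]
  rw [lp.coeFn_sum, Finset.sum_apply]

/-- The direct sum of all Cuntz-Krieger families is a Cuntz-Krieger family. -/
theorem isCuntzKrieger_sumFamily (hΛ : Λ.FinitelyAligned) :
    Λ.IsCuntzKrieger (sumFamily.{u, w} Λ) where
  partial_isometry μ := by
    ext i
    exact i.isCK.partial_isometry μ
  vertex_projection v := by
    refine ⟨?_, ?_⟩
    · ext i
      exact (i.isCK.vertex_projection v).isIdempotentElem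
    · ext i
      exact (i.isCK.vertex_projection v).isSelfAdjoint
  vertex_orthogonal v w h := by
    ext i
    exact i.isCK.vertex_orthogonal v w h
  mul_eq μ ν h := by
    ext i
    exact i.isCK.mul_eq μ ν h
  star_mul_eq μ ν := by
    ext i
    rw [finsum_apply_lp hΛ]
    exact i.isCK.star_mul_eq μ ν
  prod_eq_zero v E hE hE' := by
    ext i
    refine Eq.trans ?_ (i.isCK.prod_eq_zero v E hE hE')
    clear hE hE'
    induction E with
    | nil => rfl
    | cons μ E ih =>
      simp only [List.foldr_cons]
      rw [← ih]
      rfl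

/-- `{s_μ}` is a Cuntz-Krieger `Λ`-family in `C*(Λ)`. -/
theorem isCuntzKrieger_gen (hΛ : Λ.FinitelyAligned) : Λ.IsCuntzKrieger (gen.{u, w} Λ) := by
  have H := isCuntzKrieger_sumFamily.{u, w} hΛ
  refine ⟨fun μ => Subtype.ext (H.partial_isometry μ), fun v => ⟨?_, ?_⟩,
    fun v w h => Subtype.ext (H.vertex_orthogonal v w h),
    fun μ ν h => Subtype.ext (H.mul_eq μ ν h), fun μ ν => Subtype.ext ?_,
    fun v E hE hE' => Subtype.ext ?_⟩
  · exact Subtype.ext (H.vertex_projection v).isIdempotentElem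
  · exact Subtype.ext (H.vertex_projection v).isSelfAdjoint
  · refine (H.star_mul_eq μ ν).trans ?_
    rw [finsum_mem_eq_finite_toFinset_sum _ (hΛ μ ν),
      finsum_mem_eq_finite_toFinset_sum _ (hΛ μ ν)]
    simp only [AddSubmonoidClass.coe_finsetSum]
    rfl
  · refine Eq.trans ?_ (H.prod_eq_zero v E hE hE')
    clear hE hE'
    induction E with
    | nil => rfl
    | cons μ E ih =>
      simp only [List.foldr_cons]
      rw [← ih]
      rfl

/-- The universal property of `C*(Λ)`. -/
theorem existsUnique_lift {B : Type w} [NonUnitalCStarAlgebra B] (t : Λ.Path → B)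
    (ht : Λ.IsCuntzKrieger t) :
    ∃! φ : CStar.{u, w} Λ →⋆ₙₐ[ℂ] B, ∀ μ, φ (gen Λ μ) = t μ := by
  let i : CKFamily.{u, w} Λ := ⟨B, t, ht⟩
  let ev : lp (fun i : CKFamily.{u, w} Λ => i.Alg) ∞ →⋆ₙₐ[ℂ] B :=
    { toFun := fun a => a i
      map_smul' := fun _ _ => rfl
      map_zero' := rfl
      map_add' := fun _ _ => rfl
      map_mul' := fun _ _ => rfl
      map_star' := fun _ => rfl }
  let ψ : CStar.{u, w} Λ →⋆ₙₐ[ℂ] B :=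
    ev.comp (NonUnitalStarSubalgebraClass.subtype (cstarSubalgebra.{u, w} Λ))
  have hψ : ∀ μ, ψ (gen Λ μ) = t μ := fun μ => rfl
  refine ⟨ψ, hψ, fun φ hφ => ?_⟩
  have hcont : ∀ χ : CStar.{u, w} Λ →⋆ₙₐ[ℂ] B, Continuous χ := fun χ =>
    AddMonoidHomClass.continuous_of_bound χ 1 fun a => by
      simpa using NonUnitalStarAlgHom.norm_apply_le χ a
  have hle : NonUnitalStarAlgebra.adjoin ℂ (Set.range (sumFamily.{u, w} Λ)) ≤
      cstarSubalgebra.{u, w} Λ := NonUnitalStarSubalgebra.le_topologicalClosure _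
  have hadj : ∀ a (ha : a ∈ NonUnitalStarAlgebra.adjoin ℂ (Set.range (sumFamily.{u, w} Λ))),
      φ ⟨a, hle ha⟩ = ψ ⟨a, hle ha⟩ := by
    intro a ha
    induction ha using NonUnitalStarAlgebra.adjoin_induction with
    | mem x hx =>
      obtain ⟨μ, rfl⟩ := hx
      exact (hφ μ).trans (hψ μ).symm
    | add x y hx hy h1 h2 =>
      have e : (⟨x + y, hle (add_mem hx hy)⟩ : CStar.{u, w} Λ) = ⟨x, hle hx⟩ + ⟨y, hle hy⟩ := rfl
      rw [e, map_add, map_add, h1, h2]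
    | zero => exact (map_zero φ).trans (map_zero ψ).symm
    | mul x y hx hy h1 h2 =>
      have e : (⟨x * y, hle (mul_mem hx hy)⟩ : CStar.{u, w} Λ) = ⟨x, hle hx⟩ * ⟨y, hle hy⟩ := rfl
      rw [e, map_mul, map_mul, h1, h2]
    | smul r x hx h1 =>
      have e : (⟨r • x, hle (SMulMemClass.smul_mem r hx)⟩ : CStar.{u, w} Λ) = r • ⟨x, hle hx⟩ := rfl
      rw [e, map_smul, map_smul, h1]
    | star x hx h1 =>
      have e : (⟨star x, hle (star_mem hx)⟩ : CStar.{u, w} Λ) = star ⟨x, hle hx⟩ := rfl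
      rw [e, map_star, map_star, h1]
  have hsub : (NonUnitalStarAlgebra.adjoin ℂ (Set.range (sumFamily.{u, w} Λ)) :
      Set (lp (fun i : CKFamily.{u, w} Λ => i.Alg) ∞)) ⊆ cstarSubalgebra.{u, w} Λ := hle
  have hdense : DenseRange (Set.inclusion hsub) :=
    (denseRange_inclusion_iff hsub).2 (fun _ ha => ha)
  have := hdense.equalizer (hcont φ) (hcont ψ) (funext fun a => hadj a.1 a.2)
  exact DFunLike.ext _ _ fun a => congrFun this a

end Universal

/-! ### Boundary paths -/

/-- A graph morphism: a functor that preserves degrees. -/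
structure GraphMorphism {k : ℕ} (Λ : KGraph.{u} k) (Γ : KGraph.{v} k) where
  /-- The underlying functor. -/
  toFunctor : Λ.Obj ⥤ Γ.Obj
  deg_map : ∀ {a b : Λ.Obj} (f : a ⟶ b), Γ.deg (toFunctor.map f) = Λ.deg f

/-- The objects of `Ω_{k,m}`: the `p ∈ ℕ^k` with `p ≤ m`. -/
@[ext]
structure OmegaObj {k : ℕ} (m : Fin k → ℕ∞) where
  /-- The element of `ℕ^k`. -/
  val : Fin k → ℕ
  le : ∀ i, (val i : ℕ∞) ≤ m i

/-- The category `Ω_{k,m}`: there is one morphism `(p, q)`, with range `p` and source `q`, for each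
pair `p ≤ q`. -/
instance OmegaObj.category {k : ℕ} (m : Fin k → ℕ∞) : SmallCategory (OmegaObj m) where
  Hom q p := PLift (p.val ≤ q.val)
  id p := ⟨le_rfl⟩
  comp f g := ⟨g.down.trans f.down⟩

instance {k : ℕ} (m : Fin k → ℕ∞) (q p : OmegaObj m) : Subsingleton (q ⟶ p) :=
  inferInstanceAs (Subsingleton (PLift _))

/-- The `k`-graph `Ω_{k,m}`, with degree `d(p, q) = q - p`. -/
abbrev Omega {k : ℕ} (m : Fin k → ℕ∞) : KGraph.{0} k where
  Obj := OmegaObj m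
  countable := by
    have : Function.Injective (fun x : OmegaObj m => x.val) := fun _ _ h => OmegaObj.ext h
    have : Countable (OmegaObj m) := this.countable
    infer_instance
  deg {q p} _ := q.val - p.val
  deg_id _ := by simp
  deg_comp {a b c} f g := by
    have h1 : b.val ≤ a.val := f.down
    have h2 : c.val ≤ b.val := g.down
    funext i
    have h3 : b.val i ≤ a.val i := h1 i
    have h4 : c.val i ≤ b.val i := h2 i
    change a.val i - c.val i = (b.val i - c.val i) + (a.val i - b.val i)
    omega
  factor {a b} f m' n h := by
    have h1 : b.val ≤ a.val := f.down
    have h2 : ∀ i, a.val i = b.val i + m' i + n i := fun i => by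
      have h3 : a.val i - b.val i = m' i + n i := congrFun h i
      have h4 : b.val i ≤ a.val i := h1 i
      omega
    refine ⟨⟨⟨b.val + m', fun i => le_trans ?_ (a.le i)⟩, ⟨?_⟩, ⟨?_⟩⟩, ⟨?_, ?_, ?_⟩, ?_⟩
    · have := h2 i
      simp only [Pi.add_apply]
      exact_mod_cast (by omega : b.val i + m' i ≤ a.val i)
    · intro i
      have := h2 i
      simp only [Pi.add_apply]
      omega
    · intro i
      simp
    · funext i
      simp
    · funext i
      have := h2 i
      simp only [Pi.sub_apply, Pi.add_apply]
      omega
    · exact Subsingleton.elim _ _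
    · rintro ⟨c, g, g'⟩ ⟨hc, -, -⟩
      have h3 : b.val ≤ c.val := g'.down
      have h4 : c = ⟨b.val + m', fun i => le_trans (by
          have := h2 i
          simp only [Pi.add_apply]
          exact_mod_cast (by omega : b.val i + m' i ≤ a.val i)) (a.le i)⟩ := by
        ext i
        have h5 : c.val i - b.val i = m' i := congrFun hc i
        have h6 : b.val i ≤ c.val i := h3 i
        change c.val i = b.val i + m' i
        omega
      subst h4
      congr 1

/-- A graph morphism `x : Ω_{k,m} → Λ`, for some `m ∈ (ℕ ∪ {∞})^k`. -/
structure GenPath {k : ℕ} (Λ : KGraph.{u} k) where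
  /-- The degree `d(x) = m`. -/
  deg : Fin k → ℕ∞
  /-- The graph morphism. -/
  mor : GraphMorphism (Omega deg) Λ

namespace GenPath

variable {k : ℕ} {Λ : KGraph.{u} k}

/-- The vertex `x(n)`, for `n ≤ d(x)`. -/
abbrev vert (x : Λ.GenPath) (n : OmegaObj x.deg) : Λ.Obj := x.mor.toFunctor.obj n

/-- The object `0` of `Ω_{k,m}`. -/
def origin (m : Fin k → ℕ∞) : OmegaObj m := ⟨0, by simp⟩

theorem origin_le {m : Fin k → ℕ∞} (p : OmegaObj m) : (origin m).val ≤ p.val :=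
  fun _ => Nat.zero_le _

/-- The range `r(x) = x(0)`. -/
abbrev rng (x : Λ.GenPath) : Λ.Obj := x.vert (origin x.deg)

/-- The morphism `x(p, q) : x(q) ⟶ x(p)`, for `p ≤ q ≤ d(x)`. -/
def seg (x : Λ.GenPath) (p q : OmegaObj x.deg) (h : p.val ≤ q.val) : x.vert q ⟶ x.vert p :=
  x.mor.toFunctor.map (X := q) (Y := p) (PLift.up h)

theorem deg_seg (x : Λ.GenPath) (p q : OmegaObj x.deg) (h : p.val ≤ q.val) :
    Λ.deg (x.seg p q h) = q.val - p.val := x.mor.deg_map (a := q) (b := p) _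

theorem seg_comp_seg (x : Λ.GenPath) (p q r : OmegaObj x.deg) (h : p.val ≤ q.val)
    (h' : q.val ≤ r.val) : x.seg q r h' ≫ x.seg p q h = x.seg p r (h.trans h') :=
  (x.mor.toFunctor.map_comp (X := r) (Y := q) (Z := p) (PLift.up h') (PLift.up h)).symm

/-- Boundary paths. -/
def IsBoundary (x : Λ.GenPath) : Prop :=
  ∃ n₀ : Fin k → ℕ, (∀ i, (n₀ i : ℕ∞) ≤ x.deg i) ∧
    ∀ n : OmegaObj x.deg, n₀ ≤ n.val → ∀ i, (n.val i : ℕ∞) = x.deg i →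
      ¬ ∃ μ : Λ.Path, μ.rng = x.vert n ∧ μ.deg = Pi.single i 1

end GenPath

section Concat

variable {k : ℕ} {Λ : KGraph.{u} k}

/-- Paths with the same range, degree and a common extension agree. -/
theorem prefix_unique {a v : Λ.Obj} (f : a ⟶ v) (P Q : Σ c : Λ.Obj, (a ⟶ c) × (c ⟶ v))
    (hP : P.2.1 ≫ P.2.2 = f) (hQ : Q.2.1 ≫ Q.2.2 = f) (h : Λ.deg P.2.2 = Λ.deg Q.2.2) : P = Q := by
  have h1 := Λ.deg_comp P.2.1 P.2.2
  have h2 := Λ.deg_comp Q.2.1 Q.2.2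
  rw [hP] at h1
  rw [hQ, ← h] at h2
  have h3 : Λ.deg P.2.1 = Λ.deg Q.2.1 := add_left_cancel (h1.symm.trans h2)
  exact (Λ.factor f _ _ h1).unique ⟨rfl, rfl, hP⟩ ⟨h.symm, h3.symm, hQ⟩

theorem cancel {a b v : Λ.Obj} (f g : a ⟶ b) (e : b ⟶ v) (h : f ≫ e = g ≫ e) : f = g := by
  have := prefix_unique (f ≫ e) ⟨b, f, e⟩ ⟨b, g, e⟩ rfl h.symm rfl
  simpa using this

/-- A coherent family of paths `I q` with range `v` and degree `q`, for `q ≤ m`, gives a graph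
morphism on `Ω_{k,m}` whose segments `(0, q)` are the `I q`. -/
noncomputable def ofInitial {v : Λ.Obj} (m : Fin k → ℕ∞) (I : OmegaObj m → Σ c : Λ.Obj, (c ⟶ v))
    (hdeg : ∀ q, Λ.deg (I q).2 = q.val)
    (hI : ∀ p q : OmegaObj m, p.val ≤ q.val → ∃ σ : (I q).1 ⟶ (I p).1, σ ≫ (I p).2 = (I q).2) :
    GraphMorphism (Omega m) Λ where
  toFunctor :=
    { obj := fun q => (I q).1
      map := fun {q p} f => (hI p q f.down).choose
      map_id := fun q => cancel _ _ (I q).2 (by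
        rw [(hI q q le_rfl).choose_spec, Category.id_comp])
      map_comp := fun {a b c} f g => cancel _ _ (I c).2 (by
        rw [(hI c a (f ≫ g).down).choose_spec, Category.assoc, (hI c b g.down).choose_spec,
          (hI b a f.down).choose_spec]) }
  deg_map {q p} f := by
    have h := Λ.deg_comp (hI p q f.down).choose (I p).2
    rw [(hI p q f.down).choose_spec, hdeg, hdeg] at h
    exact (tsub_eq_of_eq_add_rev h).symm

variable (μ : Λ.Path) (x : Λ.GenPath) (h : μ.src = x.rng)

/-- `q - d(μ)` (truncated) as an object of `Ω_{k,d(x)}`, for `q ≤ d(x) + d(μ)`. -/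
def shift (q : OmegaObj fun i => x.deg i + μ.deg i) : OmegaObj x.deg :=
  ⟨q.val - μ.deg, fun i => by
    have := q.le i
    simp only [Pi.sub_apply, ENat.natCast_sub]
    exact tsub_le_iff_right.2 this⟩

/-- The path `μ x(0, q - d(μ))`. -/
def extended (q : OmegaObj fun i => x.deg i + μ.deg i) : x.vert (shift μ x q) ⟶ μ.rng :=
  x.seg (GenPath.origin x.deg) (shift μ x q) (GenPath.origin_le _) ≫ eqToHom h.symm ≫ μ.hom

theorem deg_eqToHom {a b : Λ.Obj} (e : a = b) : Λ.deg (eqToHom e) = 0 := by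
  subst e
  exact Λ.deg_id a

theorem extended_deg (q : OmegaObj fun i => x.deg i + μ.deg i) :
    Λ.deg (extended μ x h q) = q.val + (μ.deg - q.val) := by
  rw [extended, Λ.deg_comp, Λ.deg_comp, deg_eqToHom, x.deg_seg]
  change μ.deg + 0 + ((q.val - μ.deg) - 0) = _
  funext i
  simp only [Pi.sub_apply, Pi.add_apply, Pi.zero_apply]
  omega

/-- The segment `(0, q)` of the path `μ x(0, q - d(μ))`. -/
noncomputable def concatInitial (q : OmegaObj fun i => x.deg i + μ.deg i) :
    Σ c : Λ.Obj, (c ⟶ μ.rng) :=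
  let P := (Λ.factor (extended μ x h q) _ _ (extended_deg μ x h q)).choose
  ⟨P.1, P.2.2⟩

theorem concatInitial_spec (q : OmegaObj fun i => x.deg i + μ.deg i) :
    Λ.deg (concatInitial μ x h q).2 = q.val ∧
      ∃ τ : x.vert (shift μ x q) ⟶ (concatInitial μ x h q).1,
        τ ≫ (concatInitial μ x h q).2 = extended μ x h q :=
  have H := (Λ.factor (extended μ x h q) _ _ (extended_deg μ x h q)).choose_spec.1
  ⟨H.1, _, H.2.2⟩

theorem concatInitial_coherent (p q : OmegaObj fun i => x.deg i + μ.deg i)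
    (hpq : p.val ≤ q.val) : ∃ σ : (concatInitial μ x h q).1 ⟶ (concatInitial μ x h p).1,
      σ ≫ (concatInitial μ x h p).2 = (concatInitial μ x h q).2 := by
  obtain ⟨hq, τ, hτ⟩ := concatInitial_spec μ x h q
  obtain ⟨hp, τ', hτ'⟩ := concatInitial_spec μ x h p
  obtain ⟨⟨c, ρ, g⟩, ⟨hg, -, hρ⟩, -⟩ := Λ.factor (concatInitial μ x h q).2 p.val (q.val - p.val)
    (by rw [hq, add_tsub_cancel_of_le hpq])
  dsimp only at hg hρ
  have hs : (shift μ x p).val ≤ (shift μ x q).val := tsub_le_tsub_right hpq _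
  have he : x.seg _ _ hs ≫ extended μ x h p = extended μ x h q := by
    rw [extended, extended, ← Category.assoc, x.seg_comp_seg]
  have key := prefix_unique (extended μ x h q) ⟨c, τ ≫ ρ, g⟩
    ⟨_, x.seg _ _ hs ≫ τ', (concatInitial μ x h p).2⟩
    (by simp only [Category.assoc, hρ, hτ]) (by
      rw [← he, ← hτ']
      exact Category.assoc _ _ _) (hg.trans hp.symm)
  have key' : (⟨c, g⟩ : Σ c : Λ.Obj, (c ⟶ μ.rng)) = concatInitial μ x h p :=
    congrArg (fun P : Σ c : Λ.Obj, (x.vert (shift μ x q) ⟶ c) × (c ⟶ μ.rng) =>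
      (⟨P.1, P.2.2⟩ : Σ c : Λ.Obj, (c ⟶ μ.rng))) key
  rw [← key']
  exact ⟨ρ, hρ⟩

/-- The graph morphism `μx : Ω_{k,d(x)+d(μ)} → Λ`, defined when `s(μ) = r(x)`: its segment `(0, q)`
is that of the path `μ x(0, q - d(μ))`. -/
noncomputable def GenPath.concat (x : Λ.GenPath) (μ : Λ.Path) (h : μ.src = x.rng) : Λ.GenPath where
  deg i := x.deg i + μ.deg i
  mor := ofInitial (v := μ.rng) _ (concatInitial μ x h)
    (fun q => (concatInitial_spec μ x h q).1) (concatInitial_coherent μ x h)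

end Concat

section Aperiodicity

variable {k : ℕ} (Λ : KGraph.{u} k)

/-- The aperiodicity condition (B): every vertex `v` is the range of a boundary path `x` such that
`μx ≠ νx` for all distinct paths `μ, ν` with source `v`. -/
def ConditionB : Prop :=
  ∀ v : Λ.Obj, ∃ x : Λ.GenPath, x.IsBoundary ∧ x.rng = v ∧
    ∀ (μ ν : Λ.Path) (hμ : μ.src = x.rng) (hν : ν.src = x.rng), μ ≠ ν →
      x.concat μ hμ ≠ x.concat ν hν

end Aperiodicity

end KGraph

/-! Finite sums $y$ of elements $s_\mu s_\nu^*$ with $s(\mu)=s(\nu)$ are dense in $C^*(\Lambda)$.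
Let $y_0$ be the part of such a sum with $d(\mu)=d(\nu)$. The heart of the proof is the estimate
$\|y_0\|\le\|\pi(y)\|$ (`norm_diagonal_le`): the projection onto degree zero is controlled by the
image under $\pi$.

To obtain it, enlarge the finitely many paths in $y$ to a finite saturated set `S`
(`exists_finite_saturated`). The elements $s_\mu s_\nu^*$ with $\mu,\nu\in S$ of equal degree and
source span a finite-dimensional $C^*$-algebra, which is also spanned by matrix units
(`range_eq_sum_matUnit`), sorted into blocks by degree and source. A block vanishes if its tails
(the $\nu$ of nonzero degree with $\mu\nu\in S$) are exhaustive. Otherwise condition (B) gives a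
path $\rho$ that has no common extension with any tail, and such that $\beta\rho$ and $\beta'\rho$
have none whenever $\beta,\beta'$ are final segments of different degrees, after initial segments in
`S`, of paths in `S` (`ConditionB.exists_avoids`). The range projections of the paths $\nu\rho$,
with $\nu$ in the block, add up to a projection that commutes with the finite-dimensional algebra,
keeps the matrix units of this block nonzero under $\pi$, kills the other blocks, and compresses
every term with $d(\mu)\ne d(\nu)$ to zero. All these compressions together are injective, hence
isometric, on the finite-dimensional algebra, and they send $y_0$ to compressions of $\pi(y)$.

Now let $\pi(a)=0$, put $b=a^*a$ and choose $y$ close to $b$. Then $y_0$ is small. It is the average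
of the gauge translates of $y$ over the $N$-th roots of unity, so the average of the translates of
$b$ is small too. These translates are positive, and those near the identity are close to $b$ and
make up a fraction of all translates that does not depend on $y$. Hence $b=0$
(`eq_zero_of_map_eq_zero`). The finite average replaces integration over the torus and the
faithfulness of the conditional expectation. -/

namespace KGraph

open KGraph.Path

/-! ### Paths, initial segments and minimal common extensions -/

section PathAlgebra

variable {k : ℕ} {Λ : KGraph.{u} k}

namespace Path

@[simp] theorem comp_src (μ ν : Λ.Path) (h : μ.src = ν.rng) : (μ.comp ν h).src = ν.src := rfl

@[simp] theorem deg_comp (μ ν : Λ.Path) (h : μ.src = ν.rng) :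
    (μ.comp ν h).deg = μ.deg + ν.deg := by
  simp [deg, comp, Λ.deg_comp, deg_eqToHom]

@[simp] theorem deg_vertex (v : Λ.Obj) : (Λ.vertex v).deg = 0 := Λ.deg_id v

theorem comp_assoc (μ ν ρ : Λ.Path) (h : μ.src = ν.rng) (h' : ν.src = ρ.rng) :
    (μ.comp ν h).comp ρ h' = μ.comp (ν.comp ρ h') h := by
  simp [comp]

theorem comp_vertex (μ : Λ.Path) {v : Λ.Obj} (h : μ.src = v) :
    μ.comp (Λ.vertex v) h = μ := by
  subst h
  simp [comp, vertex]

theorem vertex_comp (μ : Λ.Path) {v : Λ.Obj} (h : v = μ.rng) :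
    (Λ.vertex v).comp μ h = μ := by
  subst h
  simp [comp, vertex]

theorem comp_eq_mk {a b c : Λ.Obj} (f : a ⟶ b) (g : b ⟶ c) :
    comp (Λ := Λ) ⟨b, c, g⟩ ⟨a, b, f⟩ rfl = ⟨a, c, f ≫ g⟩ := by
  simp [comp]

theorem exists_factor (κ : Λ.Path) (m n : Fin k → ℕ) (hκ : κ.deg = m + n) :
    ∃ (α β : Λ.Path) (h : α.src = β.rng), α.deg = m ∧ β.deg = n ∧ α.comp β h = κ := by
  obtain ⟨⟨c, f, g⟩, ⟨h1, h2, h3⟩, -⟩ := Λ.factor κ.hom m n hκ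
  refine ⟨⟨c, κ.rng, g⟩, ⟨κ.src, c, f⟩, rfl, h1, h2, ?_⟩
  rw [comp_eq_mk]
  dsimp only at h3
  rw [h3]

/-- This is unique factorisation for bundled paths: since endpoints are part of the data, equality
of composites needs no transport along equalities of objects. -/
theorem comp_inj {α β α' β' : Λ.Path} {h : α.src = β.rng} {h' : α'.src = β'.rng}
    (e : α.comp β h = α'.comp β' h') (hd : α.deg = α'.deg) : α = α' ∧ β = β' := by
  obtain ⟨a, b, f⟩ := α
  obtain ⟨c, d, g⟩ := β
  obtain ⟨a', b', f'⟩ := α'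
  obtain ⟨c', d', g'⟩ := β'
  dsimp only at h h'
  subst h h'
  rw [comp_eq_mk, comp_eq_mk] at e
  obtain ⟨rfl, rfl, e⟩ := Path.mk.inj e
  have := prefix_unique (g ≫ f) ⟨a, g, f⟩ ⟨a', g', f'⟩ rfl (eq_of_heq e).symm hd
  cases this
  exact ⟨rfl, rfl⟩

theorem comp_left_cancel {α β β' : Λ.Path} {h : α.src = β.rng} {h' : α.src = β'.rng}
    (e : α.comp β h = α.comp β' h') : β = β' := (comp_inj e rfl).2

theorem eq_vertex_of_deg {μ : Λ.Path} (h : μ.deg = 0) : μ = Λ.vertex μ.rng := by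
  have e : (Λ.vertex μ.rng).comp μ rfl = μ.comp (Λ.vertex μ.src) rfl :=
    (vertex_comp μ rfl).trans (comp_vertex μ rfl).symm
  exact (comp_inj e (by simp [h])).1.symm

theorem comp_eq_left {μ α : Λ.Path} (h : μ.src = α.rng) (hα : α.deg = 0) : μ.comp α h = μ := by
  have e := eq_vertex_of_deg hα
  obtain ⟨v, hv⟩ : ∃ v, v = α.rng := ⟨_, rfl⟩
  rw [← hv] at e
  subst e
  exact comp_vertex μ h

/-- `μ.Prefix κ`: the path `κ` extends `μ`. -/
def Prefix (μ κ : Λ.Path) : Prop := ∃ (α : Λ.Path) (h : μ.src = α.rng), μ.comp α h = κ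

theorem prefix_comp (μ α : Λ.Path) (h : μ.src = α.rng) : μ.Prefix (μ.comp α h) := ⟨α, h, rfl⟩

theorem Prefix.trans {μ ν κ : Λ.Path} (h : μ.Prefix ν) (h' : ν.Prefix κ) : μ.Prefix κ := by
  obtain ⟨α, hα, rfl⟩ := h
  obtain ⟨β, hβ, rfl⟩ := h'
  exact ⟨α.comp β hβ, hα, (comp_assoc _ _ _ _ _).symm⟩

theorem Prefix.deg_le {μ κ : Λ.Path} (h : μ.Prefix κ) : μ.deg ≤ κ.deg := by
  obtain ⟨α, hα, rfl⟩ := h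
  simp

theorem Prefix.eq_of_deg {μ ν κ : Λ.Path} (h : μ.Prefix κ) (h' : ν.Prefix κ)
    (hd : μ.deg = ν.deg) : μ = ν := by
  obtain ⟨α, hα, rfl⟩ := h
  obtain ⟨β, hβ, e⟩ := h'
  exact (comp_inj e hd.symm).1.symm

/-- Prefixes of a path are nested according to their degrees. -/
theorem Prefix.of_deg_le {μ ν κ : Λ.Path} (h : μ.Prefix κ) (h' : ν.Prefix κ)
    (hd : μ.deg ≤ ν.deg) : μ.Prefix ν := by
  obtain ⟨α, β, hαβ, h1, h2, rfl⟩ := ν.exists_factor μ.deg (ν.deg - μ.deg)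
    (add_tsub_cancel_of_le hd).symm
  rw [Prefix.eq_of_deg h ((prefix_comp _ _ _).trans h') h1.symm]
  exact prefix_comp _ _ _

end Path

/-- A common extension of two paths factors through a minimal common extension. -/
theorem exists_Lmin_factor {μ ν α β : Λ.Path} {h : μ.src = α.rng} {h' : ν.src = β.rng}
    (e : μ.comp α h = ν.comp β h') :
    ∃ (ξ ξ' ζ : Λ.Path) (h₁ : ξ.src = ζ.rng) (h₂ : ξ'.src = ζ.rng),
      (ξ, ξ') ∈ Λ.Lmin μ ν ∧ ξ.comp ζ h₁ = α ∧ ξ'.comp ζ h₂ = β := by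
  have hμ : μ.Prefix (μ.comp α h) := prefix_comp _ _ _
  have hν : ν.Prefix (μ.comp α h) := by rw [e]; exact prefix_comp _ _ _
  obtain ⟨κ, ζ, h1, h2, -, h3⟩ := (μ.comp α h).exists_factor (μ.deg ⊔ ν.deg)
    ((μ.comp α h).deg - (μ.deg ⊔ ν.deg))
    (add_tsub_cancel_of_le (sup_le hμ.deg_le hν.deg_le)).symm
  have hκ : κ.Prefix (μ.comp α h) := ⟨ζ, h1, h3⟩
  obtain ⟨ξ, hξ, e1⟩ := hμ.of_deg_le hκ (by rw [h2]; exact le_sup_left)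
  obtain ⟨ξ', hξ', e2⟩ := hν.of_deg_le hκ (by rw [h2]; exact le_sup_right)
  have hs : ξ.src = κ.src := by rw [← e1, comp_src]
  have hs' : ξ'.src = κ.src := by rw [← e2, comp_src]
  refine ⟨ξ, ξ', ζ, hs.trans h1, hs'.trans h1, ⟨hξ, hξ', e1.trans e2.symm, ?_⟩, ?_, ?_⟩
  · exact (congrArg Path.deg e1).trans h2
  · subst e1
    exact comp_left_cancel ((comp_assoc _ _ _ _ _).symm.trans h3)
  · subst e2
    exact comp_left_cancel ((comp_assoc _ _ _ _ _).symm.trans (h3.trans e))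

theorem Lmin_nonempty_iff {μ ν : Λ.Path} :
    (Λ.Lmin μ ν).Nonempty ↔ ∃ κ : Λ.Path, μ.Prefix κ ∧ ν.Prefix κ := by
  constructor
  · rintro ⟨p, h1, h2, h3, -⟩
    exact ⟨_, ⟨_, h1, rfl⟩, ⟨_, h2, h3.symm⟩⟩
  · rintro ⟨κ, ⟨α, h, rfl⟩, ⟨β, h', e⟩⟩
    obtain ⟨ξ, ξ', -, -, -, h1, -⟩ := exists_Lmin_factor e.symm
    exact ⟨_, h1⟩

theorem Lmin_symm {μ ν : Λ.Path} {p : Λ.Path × Λ.Path} (h : p ∈ Λ.Lmin μ ν) :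
    p.swap ∈ Λ.Lmin ν μ := by
  obtain ⟨h1, h2, h3, h4⟩ := h
  exact ⟨h2, h1, h3.symm, (congrArg Path.deg h3.symm).trans (h4.trans (sup_comm _ _))⟩

theorem Lmin_swap (μ ν : Λ.Path) : Λ.Lmin ν μ = Prod.swap '' Λ.Lmin μ ν := by
  ext p
  constructor
  · exact fun h => ⟨p.swap, Lmin_symm h, p.swap_swap⟩
  · rintro ⟨q, hq, rfl⟩
    exact Lmin_symm hq

theorem Lmin_self (μ : Λ.Path) : Λ.Lmin μ μ = {(Λ.vertex μ.src, Λ.vertex μ.src)} := by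
  ext ⟨α, β⟩
  simp only [Set.mem_singleton_iff, Prod.mk.injEq]
  constructor
  · rintro ⟨h1, h2, h3, h4⟩
    dsimp only at h1 h2 h3 h4
    have hα : α.deg = 0 := by simpa using h4
    have hβ : β = α := (comp_left_cancel h3).symm
    rw [hβ, h1]
    exact ⟨eq_vertex_of_deg hα, eq_vertex_of_deg hα⟩
  · rintro ⟨rfl, rfl⟩
    exact ⟨rfl, rfl, rfl, by rw [sup_idem]; exact congrArg Path.deg (comp_vertex μ rfl)⟩

end PathAlgebra

/-! ### Finite saturated sets of paths -/

section Saturation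

variable {k : ℕ} {Λ : KGraph.{u} k}

/-- A set `S` of paths is saturated if, for `μ, ν, σ ∈ S` such that `μ, ν` have equal source and
degree and for `(α, β) ∈ Λmin(ν, σ)`, the path `μα` belongs to `S`. The partial isometries
`t_μ t_ν^*` with such `μ, ν ∈ S` then span a `*`-algebra. -/
def IsSaturated (S : Set Λ.Path) : Prop :=
  ∀ μ ∈ S, ∀ ν ∈ S, ∀ σ ∈ S, μ.deg = ν.deg → μ.src = ν.src →
    ∀ p ∈ Λ.Lmin ν σ, ∀ h : μ.src = p.1.rng, μ.comp p.1 h ∈ S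

/-- The total degree of a path. -/
def Path.size (μ : Λ.Path) : ℕ := ∑ i, μ.deg i

theorem Path.size_comp (μ ν : Λ.Path) (h : μ.src = ν.rng) :
    (μ.comp ν h).size = μ.size + ν.size := by
  simp [Path.size, Finset.sum_add_distrib]

theorem Path.deg_eq_zero_of_size {μ : Λ.Path} (h : μ.size = 0) : μ.deg = 0 := by
  funext i
  exact (Finset.sum_eq_zero_iff.1 h) i (Finset.mem_univ i)

theorem Path.size_mono {μ ν : Λ.Path} (h : μ.deg ≤ ν.deg) : μ.size ≤ ν.size :=
  Finset.sum_le_sum fun i _ => h i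

theorem Path.deg_eq_of_size {μ ν : Λ.Path} (h : μ.deg ≤ ν.deg) (h' : ν.size ≤ μ.size) :
    μ.deg = ν.deg := by
  have h1 := (Finset.sum_eq_sum_iff_of_le (s := Finset.univ) fun i _ => h i).1
    (le_antisymm (Path.size_mono h) h')
  exact funext fun i => h1 i (Finset.mem_univ i)

theorem Path.deg_eq_of_mem_Lmin {μ ν σ : Λ.Path} {p : Λ.Path × Λ.Path} (hp : p ∈ Λ.Lmin ν σ)
    (hd : μ.deg = ν.deg) (h : μ.src = p.1.rng) : (μ.comp p.1 h).deg = ν.deg ⊔ σ.deg := by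
  obtain ⟨h1, -, -, h4⟩ := hp
  rw [← h4, Path.deg_comp, Path.deg_comp, hd]

/-- The paths `μα` that the saturation of `S` needs. -/
def minExtensions (S : Set Λ.Path) : Set Λ.Path :=
  {κ | ∃ μ ∈ S, ∃ ν ∈ S, ∃ σ ∈ S, μ.deg = ν.deg ∧ μ.src = ν.src ∧
    ∃ p ∈ Λ.Lmin ν σ, ∃ h : μ.src = p.1.rng, μ.comp p.1 h = κ}

/-- The paths obtained from elements of `B` by replacing an initial segment by an element of `S` of
the same degree. -/
def prefixReplacements (S B : Set Λ.Path) : Set Λ.Path :=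
  {κ | ∃ b ∈ B, ∃ μ ∈ S, ∃ (ν η : Λ.Path) (h : ν.src = η.rng) (h' : μ.src = η.rng),
    ν.comp η h = b ∧ ν.deg = μ.deg ∧ μ.comp η h' = κ}

theorem finite_minExtensions (hΛ : Λ.FinitelyAligned) {S : Set Λ.Path} (hS : S.Finite) :
    (minExtensions S).Finite := by
  have : (⋃ μ ∈ S, ⋃ ν ∈ S, ⋃ σ ∈ S, ⋃ p ∈ Λ.Lmin ν σ,
      {κ | ∃ h : μ.src = p.1.rng, μ.comp p.1 h = κ}).Finite := by
    refine hS.biUnion fun μ _ => hS.biUnion fun ν _ => hS.biUnion fun σ _ =>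
      (hΛ ν σ).biUnion fun p _ => Set.Subsingleton.finite ?_
    rintro _ ⟨h, rfl⟩ _ ⟨h', rfl⟩
    rfl
  refine this.subset ?_
  rintro κ ⟨μ, hμ, ν, hν, σ, hσ, -, -, p, hp, h⟩
  simp only [Set.mem_iUnion]
  exact ⟨μ, hμ, ν, hν, σ, hσ, p, hp, h⟩

theorem finite_prefixReplacements {S B : Set Λ.Path} (hS : S.Finite) (hB : B.Finite) :
    (prefixReplacements S B).Finite := by
  have : (⋃ b ∈ B, ⋃ μ ∈ S, {κ | ∃ (ν η : Λ.Path) (h : ν.src = η.rng) (h' : μ.src = η.rng),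
      ν.comp η h = b ∧ ν.deg = μ.deg ∧ μ.comp η h' = κ}).Finite := by
    refine hB.biUnion fun b _ => hS.biUnion fun μ _ => Set.Subsingleton.finite ?_
    rintro _ ⟨ν, η, h, h', rfl, h1, rfl⟩ _ ⟨ν', η', k, k', e, h2, rfl⟩
    obtain ⟨-, rfl⟩ := comp_inj e (h2.trans h1.symm)
    rfl
  refine this.subset ?_
  rintro κ ⟨b, hb, μ, hμ, h⟩
  simp only [Set.mem_iUnion]
  exact ⟨b, hb, μ, hμ, h⟩

/-- Two successive replacements of an initial segment amount to a single one, or else produce a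
minimal extension. If $\kappa=\nu\alpha$ arose from $b=\nu_0\eta$ as $\nu_1\eta$, then $\nu$ and
$\nu_1$ are both initial segments of $\kappa$, so $\kappa$ factors through a minimal common
extension $\nu\xi=\nu_1\xi'$ of them. -/
theorem comp_mem_prefixReplacements {S B : Set Λ.Path} {j : ℕ}
    (hsat : ∀ μ ∈ S, ∀ ν ∈ S, ∀ σ ∈ S, μ.deg = ν.deg → μ.src = ν.src → ∀ p ∈ Λ.Lmin ν σ,
      ∀ h : μ.src = p.1.rng, (μ.comp p.1 h).size < j → μ.comp p.1 h ∈ S)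
    (hB : ∀ κ ∈ minExtensions S, κ.size = j → κ ∈ B) {μ ν α κ : Λ.Path} (hμ : μ ∈ S) (hν : ν ∈ S)
    (hd : μ.deg = ν.deg) (hs : μ.src = ν.src) (h : μ.src = α.rng) (h' : ν.src = α.rng)
    (hκ : ν.comp α h' = κ) (hj : κ.size = j) (hmem : κ ∈ prefixReplacements S B) :
    μ.comp α h ∈ B ∪ prefixReplacements S B := by
  subst hκ
  obtain ⟨b, hb, ν₁, hν₁, ν₀, η, h0, h1, rfl, hd', e⟩ := hmem
  obtain ⟨ξ, ξ', ζ, hζ, hζ', hp, rfl, rfl⟩ := exists_Lmin_factor e.symm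
  obtain ⟨k1, k2, k3, k4⟩ := id hp
  dsimp only at k1 k2 k3 k4
  have hμξ : μ.src = ξ.rng := hs.trans k1
  have hsize : (μ.comp ξ hμξ).size = (ν.comp ξ k1).size := by
    simp [Path.size, hd]
  have hj' : (ν.comp ξ k1).size + ζ.size = j := by
    rw [← hj, size_comp, size_comp, size_comp, add_assoc]
  have e1 : μ.comp (ξ.comp ζ hζ) h = (μ.comp ξ hμξ).comp ζ hζ := (comp_assoc _ _ _ _ _).symm
  -- If the remainder $\zeta$ is trivial, then $\mu\alpha=\mu\xi$ is itself a minimal extension. If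
  -- not, $\mu\xi$ has size below `j`, so it is already in `S`; it has the degree of $\nu_0\xi'$,
  -- and $\mu\alpha=(\mu\xi)\zeta$ is one replacement in $b=\nu_0\xi'\zeta$.
  rcases Nat.eq_zero_or_pos ζ.size with h2 | h2
  · left
    rw [e1.trans (comp_eq_left _ (deg_eq_zero_of_size h2))]
    exact hB _ ⟨μ, hμ, ν, hν, ν₁, hν₁, hd, hs, _, hp, hμξ, rfl⟩ (by omega)
  · right
    have h3 : μ.comp ξ hμξ ∈ S := hsat μ hμ ν hν ν₁ hν₁ hd hs _ hp hμξ (by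
      change (μ.comp ξ hμξ).size < j
      omega)
    have k5 : ν₀.src = ξ'.rng := h0
    rw [e1]
    refine ⟨_, hb, _, h3, ν₀.comp ξ' k5, ζ, hζ', hζ, comp_assoc _ _ _ _ _, ?_, rfl⟩
    have k6 := congrArg Path.deg k3
    rw [Path.deg_comp, Path.deg_comp] at k6
    rw [Path.deg_comp, Path.deg_comp, hd, k6, hd']

/-- Induction on total degree. At level `j` it suffices to add the elements of `E` and the minimal
extensions of that size, and then to replace initial segments once. Joins and replacements keep
degrees below `N`, so the construction is complete once `j` exceeds the sum of the coordinates of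
`N`. -/
theorem exists_finite_saturated_below (hΛ : Λ.FinitelyAligned) {E : Set Λ.Path} (hE : E.Finite)
    {N : Fin k → ℕ} (hN : ∀ μ ∈ E, μ.deg ≤ N) (j : ℕ) :
    ∃ S : Set Λ.Path, S.Finite ∧ (∀ μ ∈ S, μ.size < j ∧ μ.deg ≤ N) ∧
      (∀ μ ∈ E, μ.size < j → μ ∈ S) ∧
      ∀ μ ∈ S, ∀ ν ∈ S, ∀ σ ∈ S, μ.deg = ν.deg → μ.src = ν.src → ∀ p ∈ Λ.Lmin ν σ,
        ∀ h : μ.src = p.1.rng, (μ.comp p.1 h).size < j → μ.comp p.1 h ∈ S := by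
  induction j with
  | zero => exact ⟨∅, Set.finite_empty, by simp, by simp, by simp⟩
  | succ j ih =>
    obtain ⟨S, hfin, hbd, hES, hsat⟩ := ih
    set B : Set Λ.Path := {κ ∈ E ∪ minExtensions S | κ.size = j} with hBdef
    have hBfin : B.Finite :=
      (hE.union (finite_minExtensions hΛ hfin)).subset fun κ hκ => hκ.1
    have hB : ∀ κ ∈ minExtensions S, κ.size = j → κ ∈ B := fun κ h h' => ⟨Or.inr h, h'⟩
    have hBdeg : ∀ κ ∈ B, κ.size = j ∧ κ.deg ≤ N := by
      rintro κ ⟨h1 | ⟨μ, hμ, ν, hν, σ, hσ, hd, hs, p, hp, h, rfl⟩, h2⟩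
      · exact ⟨h2, hN κ h1⟩
      · refine ⟨h2, ?_⟩
        rw [deg_eq_of_mem_Lmin hp hd]
        exact sup_le (hbd ν hν).2 (hbd σ hσ).2
    have hRdeg : ∀ κ ∈ B ∪ prefixReplacements S B, κ.size = j ∧ κ.deg ≤ N := by
      rintro κ (h | ⟨b, hb, μ, hμ, ν, η, h, h', rfl, hd, rfl⟩)
      · exact hBdeg κ h
      · have h1 := hBdeg _ hb
        have h2 : (μ.comp η h').deg = (ν.comp η h).deg := by simp [hd]
        have h3 : (μ.comp η h').size = (ν.comp η h).size := by simp [Path.size, hd]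
        rw [h2, h3]
        exact h1
    refine ⟨S ∪ (B ∪ prefixReplacements S B),
      hfin.union (hBfin.union (finite_prefixReplacements hfin hBfin)), ?_, ?_, ?_⟩
    · rintro μ (h | h)
      · exact ⟨(hbd μ h).1.trans (Nat.lt_succ_self j), (hbd μ h).2⟩
      · exact ⟨by have := (hRdeg μ h).1; omega, (hRdeg μ h).2⟩
    · intro μ hμ hj
      rcases Nat.lt_succ_iff_lt_or_eq.1 hj with h | h
      · exact Or.inl (hES μ hμ h)
      · exact Or.inr (Or.inl ⟨Or.inl hμ, h⟩)
    · intro μ hμ ν hν σ hσ hd hs p hp h hj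
      have key := deg_eq_of_mem_Lmin hp hd h
      have hνle : ν.size ≤ (μ.comp p.1 h).size := size_mono (by rw [key]; exact le_sup_left)
      have hσle : σ.size ≤ (μ.comp p.1 h).size := size_mono (by rw [key]; exact le_sup_right)
      have hμν : μ.size = ν.size := by simp [Path.size, hd]
      have lower : ∀ κ ∈ S ∪ (B ∪ prefixReplacements S B), κ.size < j → κ ∈ S := by
        rintro κ (h | h) h'
        · exact h
        · have := (hRdeg κ h).1
          omega
      rcases Nat.lt_succ_iff_lt_or_eq.1 hj with hj | hj
      · exact Or.inl (hsat μ (lower μ hμ (by omega)) ν (lower ν hν (by omega)) σ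
          (lower σ hσ (by omega)) hd hs p hp h hj)
      -- If $\mu$ already has full size `j`, the extension has degree zero and nothing new arises.
      by_cases hμj : μ.size = j
      · have h1 : p.1.size = 0 := by
          rw [size_comp] at hj
          omega
        rw [comp_eq_left h (deg_eq_zero_of_size h1)]
        exact hμ
      have hμj' : μ.size < j := by omega
      have hμS := lower μ hμ hμj'
      have hνS := lower ν hν (by omega)
      rcases hσ with hσ | hσ
      · exact Or.inr (Or.inl (hB _ ⟨μ, hμS, ν, hνS, σ, hσ, hd, hs, p, hp, h, rfl⟩ hj))
      right
      have hσj := (hRdeg σ hσ).1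
      obtain ⟨α, β⟩ := p
      obtain ⟨h1, h2, h3, h4⟩ := id hp
      dsimp only at h h1 h2 h3 h4 key hj
      -- As $\sigma$ has full size, its degree is the join. Hence $\nu\alpha=\sigma$, and
      -- $\mu\alpha$ replaces the initial segment $\nu$ of $\sigma$ by $\mu$.
      have h5 : σ.deg = (μ.comp α h).deg :=
        deg_eq_of_size (by rw [key]; exact le_sup_right) (by omega)
      have h6 : β.deg = 0 := by
        have := congrArg Path.deg h3
        rw [h4, ← key, ← h5, Path.deg_comp] at this
        simpa using this.symm
      have h7 : ν.comp α h1 = σ := by rw [h3, comp_eq_left h2 h6]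
      rcases hσ with hσ | hσ
      · exact Or.inr ⟨σ, hσ, μ, hμS, ν, α, h1, h, h7, hd.symm, rfl⟩
      · exact comp_mem_prefixReplacements hsat hB hμS hνS hd hs h h1 h7 hσj hσ

/-- Every finite set of paths is contained in a finite saturated one. -/
theorem exists_finite_saturated (hΛ : Λ.FinitelyAligned) {E : Set Λ.Path} (hE : E.Finite) :
    ∃ S : Set Λ.Path, S.Finite ∧ E ⊆ S ∧ IsSaturated S := by
  obtain ⟨N, hN⟩ : ∃ N : Fin k → ℕ, ∀ μ ∈ E, μ.deg ≤ N := by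
    obtain ⟨N, hN⟩ := (hE.image Path.deg).bddAbove
    exact ⟨N, fun μ hμ => hN ⟨μ, hμ, rfl⟩⟩
  have hlt : ∀ μ : Λ.Path, μ.deg ≤ N → μ.size < (∑ i, N i) + 1 := fun μ h =>
    Nat.lt_succ_of_le (Finset.sum_le_sum fun i _ => h i)
  obtain ⟨S, h1, h2, h3, h4⟩ := exists_finite_saturated_below hΛ hE hN ((∑ i, N i) + 1)
  refine ⟨S, h1, fun μ hμ => h3 μ hμ (hlt μ (hN μ hμ)), ?_⟩
  intro μ hμ ν hν σ hσ hd hs p hp h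
  refine h4 μ hμ ν hν σ hσ hd hs p hp h (hlt _ ?_)
  rw [deg_eq_of_mem_Lmin hp hd]
  exact sup_le (h2 ν hν).2 (h2 σ hσ).2

end Saturation

theorem mem_Lmin_comp {k : ℕ} {Λ : KGraph.{u} k} (μ α : Λ.Path) (h : μ.src = α.rng) :
    (α, Λ.vertex α.src) ∈ Λ.Lmin μ (μ.comp α h) := by
  refine ⟨h, rfl, (comp_vertex (μ.comp α h) rfl).symm, ?_⟩
  change (μ.comp α h).deg = _
  rw [Path.deg_comp, eq_comm, sup_eq_right]
  exact le_self_add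

/-- Apply saturation with $\sigma=\nu\alpha$: the minimal common extension of $\nu$ and $\nu\alpha$
is $\nu\alpha$ itself. -/
theorem IsSaturated.comp_mem {k : ℕ} {Λ : KGraph.{u} k} {S : Set Λ.Path} (hS : IsSaturated S)
    {μ ν α : Λ.Path} (hμ : μ ∈ S) (hν : ν ∈ S) (hd : μ.deg = ν.deg) (hs : μ.src = ν.src)
    (h : ν.src = α.rng) (h' : μ.src = α.rng) (hα : ν.comp α h ∈ S) : μ.comp α h' ∈ S :=
  hS μ hμ ν hν _ hα hd hs _ (mem_Lmin_comp ν α h) h'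

/-! ### Range projections and matrix units of a Cuntz–Krieger family -/

section CuntzKrieger

variable {k : ℕ} {Λ : KGraph.{u} k} {A : Type v} [NonUnitalCStarAlgebra A] {t : Λ.Path → A}

theorem IsCuntzKrieger.map (hΛ : Λ.FinitelyAligned) (ht : Λ.IsCuntzKrieger t)
    {B : Type w} [NonUnitalCStarAlgebra B] (φ : A →⋆ₙₐ[ℂ] B) :
    Λ.IsCuntzKrieger (fun μ => φ (t μ)) where
  partial_isometry μ := by
    rw [← map_star, ← map_mul, ← map_mul, ht.partial_isometry]
  vertex_projection v := by
    refine ⟨?_, ?_⟩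
    · change φ _ * φ _ = _
      rw [← map_mul, (ht.vertex_projection v).isIdempotentElem.eq]
    · change star (φ _) = _
      rw [← map_star, (ht.vertex_projection v).isSelfAdjoint.star_eq]
  vertex_orthogonal v w h := by
    rw [← map_mul, ht.vertex_orthogonal v w h, map_zero]
  mul_eq μ ν h := by
    rw [← map_mul, ht.mul_eq μ ν h]
  star_mul_eq μ ν := by
    rw [← map_star, ← map_mul, ht.star_mul_eq, finsum_mem_eq_finite_toFinset_sum _ (hΛ μ ν),
      finsum_mem_eq_finite_toFinset_sum _ (hΛ μ ν), map_sum]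
    simp only [map_mul, map_star]
  prod_eq_zero v E hE hE' := by
    have key : ∀ l : List Λ.Path,
        l.foldr (fun μ a => (φ (t (Λ.vertex v)) - φ (t μ) * star (φ (t μ))) * a)
          (φ (t (Λ.vertex v))) =
        φ (l.foldr (fun μ a => (t (Λ.vertex v) - t μ * star (t μ)) * a) (t (Λ.vertex v))) := by
      intro l
      induction l with
      | nil => rfl
      | cons μ l ih => simp only [List.foldr_cons, ih, map_mul, map_sub, map_star]
    rw [key, ht.prod_eq_zero v E hE hE', map_zero]

namespace IsCuntzKrieger

theorem vertex_mul (ht : Λ.IsCuntzKrieger t) (μ : Λ.Path) {v : Λ.Obj} (h : v = μ.rng) :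
    t (Λ.vertex v) * t μ = t μ := by
  rw [ht.mul_eq _ _ h, Path.vertex_comp]

theorem mul_vertex (ht : Λ.IsCuntzKrieger t) (μ : Λ.Path) {v : Λ.Obj} (h : μ.src = v) :
    t μ * t (Λ.vertex v) = t μ := by
  rw [ht.mul_eq _ _ h, Path.comp_vertex]

theorem star_vertex (ht : Λ.IsCuntzKrieger t) (v : Λ.Obj) :
    star (t (Λ.vertex v)) = t (Λ.vertex v) := (ht.vertex_projection v).isSelfAdjoint.star_eq

theorem vertex_mul_vertex (ht : Λ.IsCuntzKrieger t) (v : Λ.Obj) :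
    t (Λ.vertex v) * t (Λ.vertex v) = t (Λ.vertex v) :=
  (ht.vertex_projection v).isIdempotentElem.eq

theorem star_mul_vertex (ht : Λ.IsCuntzKrieger t) (μ : Λ.Path) {v : Λ.Obj} (h : v = μ.rng) :
    star (t μ) * t (Λ.vertex v) = star (t μ) := by
  rw [← ht.star_vertex, ← star_mul, ht.vertex_mul μ h]

theorem vertex_mul_star (ht : Λ.IsCuntzKrieger t) (μ : Λ.Path) {v : Λ.Obj} (h : μ.src = v) :
    t (Λ.vertex v) * star (t μ) = star (t μ) := by
  rw [← ht.star_vertex, ← star_mul, ht.mul_vertex μ h]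

theorem star_mul_eq_sum (hΛ : Λ.FinitelyAligned) (ht : Λ.IsCuntzKrieger t) (μ ν : Λ.Path) :
    star (t μ) * t ν = ∑ p ∈ (hΛ μ ν).toFinset, t p.1 * star (t p.2) := by
  rw [ht.star_mul_eq, finsum_mem_eq_finite_toFinset_sum _ (hΛ μ ν)]

theorem star_mul_eq_zero (ht : Λ.IsCuntzKrieger t) {μ ν : Λ.Path}
    (h : ¬ (Λ.Lmin μ ν).Nonempty) : star (t μ) * t ν = 0 := by
  rw [ht.star_mul_eq, Set.not_nonempty_iff_eq_empty.1 h, finsum_mem_empty]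

theorem star_mul_self (ht : Λ.IsCuntzKrieger t) (μ : Λ.Path) :
    star (t μ) * t μ = t (Λ.vertex μ.src) := by
  rw [ht.star_mul_eq, Lmin_self, finsum_mem_singleton, ht.star_vertex, ht.vertex_mul_vertex]

theorem star_comp (ht : Λ.IsCuntzKrieger t) (μ α : Λ.Path) (h : μ.src = α.rng) :
    star (t (μ.comp α h)) = star (t α) * star (t μ) := by
  rw [← ht.mul_eq, star_mul]

theorem star_mul_comp (ht : Λ.IsCuntzKrieger t) (μ α : Λ.Path) (h : μ.src = α.rng) :
    star (t μ) * t (μ.comp α h) = t α := by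
  rw [← ht.mul_eq _ _ h, ← mul_assoc, ht.star_mul_self, ht.vertex_mul α h]

theorem star_comp_mul (ht : Λ.IsCuntzKrieger t) (μ α : Λ.Path) (h : μ.src = α.rng) :
    star (t (μ.comp α h)) * t μ = star (t α) := by
  rw [← star_star (t μ), ← star_mul, ht.star_mul_comp]

theorem star_mul_mul_star (ht : Λ.IsCuntzKrieger t) (μ : Λ.Path) :
    star (t μ) * (t μ * star (t μ)) = star (t μ) := by
  rw [← mul_assoc, ht.star_mul_self, ht.vertex_mul_star μ rfl]

/-- The product is the sum of the range projections of the minimal common extensions of $\mu$ and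
$\nu$. Self-adjointness of the product is what makes range projections commute. -/
theorem range_mul_range (hΛ : Λ.FinitelyAligned) (ht : Λ.IsCuntzKrieger t) (μ ν : Λ.Path) :
    IsSelfAdjoint (t μ * star (t μ) * (t ν * star (t ν))) := by
  have e : t μ * star (t μ) * (t ν * star (t ν)) =
      ∑ p ∈ (hΛ μ ν).toFinset, t μ * (t p.1 * star (t p.2)) * star (t ν) := by
    rw [← Finset.sum_mul, ← Finset.mul_sum, ← ht.star_mul_eq_sum hΛ]
    simp only [mul_assoc]
  rw [e]
  refine isSelfAdjoint_sum _ fun p hp => ?_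
  obtain ⟨h1, h2, h3, -⟩ := (hΛ μ ν).mem_toFinset.1 hp
  have e' : t μ * (t p.1 * star (t p.2)) * star (t ν) =
      t (μ.comp p.1 h1) * star (t (μ.comp p.1 h1)) :=
    calc _ = t μ * t p.1 * star (t ν * t p.2) := by simp only [star_mul, mul_assoc]
      _ = _ := by rw [ht.mul_eq _ _ h1, ht.mul_eq _ _ h2, h3]
  rw [e']
  exact IsSelfAdjoint.mul_star_self _

theorem commute_range (hΛ : Λ.FinitelyAligned) (ht : Λ.IsCuntzKrieger t) (μ ν : Λ.Path) :
    Commute (t μ * star (t μ)) (t ν * star (t ν)) := by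
  have := ht.range_mul_range hΛ μ ν
  rw [isSelfAdjoint_iff, star_mul, star_mul, star_mul, star_star, star_star] at this
  exact this.symm

end IsCuntzKrieger

/-- The product of the projections `t_v - t_μ t_μ^*`, where `μ` runs through the list `l`. -/
def gap (t : Λ.Path → A) (v : Λ.Obj) (l : List Λ.Path) : A :=
  l.foldr (fun μ a => (t (Λ.vertex v) - t μ * star (t μ)) * a) (t (Λ.vertex v))

theorem gap_cons (v : Λ.Obj) (μ : Λ.Path) (l : List Λ.Path) :
    gap t v (μ :: l) = (t (Λ.vertex v) - t μ * star (t μ)) * gap t v l := rfl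

theorem gap_mul_vertex (ht : Λ.IsCuntzKrieger t) (v : Λ.Obj) (l : List Λ.Path) :
    gap t v l * t (Λ.vertex v) = gap t v l := by
  induction l with
  | nil => exact ht.vertex_mul_vertex v
  | cons μ l ih => rw [gap_cons, mul_assoc, ih]

theorem gap_mul_eq_self {v : Λ.Obj} {l : List Λ.Path} {y : A}
    (hv : t (Λ.vertex v) * y = y) (hl : ∀ μ ∈ l, star (t μ) * y = 0) : gap t v l * y = y := by
  induction l with
  | nil => exact hv
  | cons μ l ih =>
    rw [gap_cons, mul_assoc, ih fun ν hν => hl ν (List.mem_cons_of_mem _ hν), sub_mul, hv,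
      mul_assoc, hl μ List.mem_cons_self, mul_zero, sub_zero]

theorem commute_gap (hΛ : Λ.FinitelyAligned) (ht : Λ.IsCuntzKrieger t) {v : Λ.Obj}
    (l : List Λ.Path) {μ : Λ.Path} (hμ : μ.rng = v) :
    Commute (gap t v l) (t μ * star (t μ)) := by
  have hv : Commute (t (Λ.vertex v)) (t μ * star (t μ)) := by
    rw [Commute, SemiconjBy, ← mul_assoc, ht.vertex_mul μ hμ.symm, mul_assoc,
      ht.star_mul_vertex μ hμ.symm]
  induction l with
  | nil => exact hv
  | cons ν l ih => exact (hv.sub_left (ht.commute_range hΛ ν μ)).mul_left ih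

/-- The factors commute with $t_\mu t_\mu^*$, so the projection can be moved next to the factor
$t_v-t_\mu t_\mu^*$, which kills it. -/
theorem gap_mul_eq_zero (hΛ : Λ.FinitelyAligned) (ht : Λ.IsCuntzKrieger t) {v : Λ.Obj}
    {l : List Λ.Path} {μ : Λ.Path} (hμ : μ.rng = v) (hl : μ ∈ l) : gap t v l * t μ = 0 := by
  suffices h : gap t v l * (t μ * star (t μ)) = 0 by
    rw [← ht.partial_isometry μ, ← mul_assoc, h, zero_mul]
  induction l with
  | nil => simp at hl
  | cons ν l ih =>
    rw [gap_cons, mul_assoc]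
    rcases List.mem_cons.1 hl with rfl | h
    · rw [(commute_gap hΛ ht l hμ).eq, ← mul_assoc, sub_mul, ← mul_assoc (t (Λ.vertex v)),
        ht.vertex_mul μ hμ.symm, ← mul_assoc, ht.partial_isometry, sub_self, zero_mul]
    · rw [ih h, mul_zero]

theorem star_mul_gap_eq_zero (hΛ : Λ.FinitelyAligned) (ht : Λ.IsCuntzKrieger t) {v : Λ.Obj}
    {l : List Λ.Path} {μ : Λ.Path} (hμ : μ.rng = v) (hl : μ ∈ l) :
    star (t μ) * gap t v l = 0 := by
  rw [← ht.star_mul_mul_star, mul_assoc, ← (commute_gap hΛ ht l hμ).eq, ← mul_assoc (gap t v l),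
    gap_mul_eq_zero hΛ ht hμ hl, zero_mul, mul_zero]

/-- The paths `ν` of nonzero degree such that `μν ∈ S`. -/
def tailSet (S : Set Λ.Path) (μ : Λ.Path) : Set Λ.Path :=
  {ν | ν.deg ≠ 0 ∧ ∃ h : μ.src = ν.rng, μ.comp ν h ∈ S}

theorem finite_tailSet {S : Set Λ.Path} (hS : S.Finite) (μ : Λ.Path) : (tailSet S μ).Finite := by
  have : (⋃ κ ∈ S, {ν | ∃ h : μ.src = ν.rng, μ.comp ν h = κ}).Finite := by
    refine hS.biUnion fun κ _ => Set.Subsingleton.finite ?_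
    rintro ν ⟨h, e⟩ ν' ⟨h', e'⟩
    exact comp_left_cancel (e.trans e'.symm)
  refine this.subset ?_
  rintro ν ⟨-, h, hν⟩
  simp only [Set.mem_iUnion]
  exact ⟨_, hν, h, rfl⟩

/-- The elements of `tailSet S μ`, as a list. -/
noncomputable def tails (S : Finset Λ.Path) (μ : Λ.Path) : List Λ.Path :=
  (finite_tailSet S.finite_toSet μ).toFinset.toList

theorem mem_tails {S : Finset Λ.Path} {μ ν : Λ.Path} :
    ν ∈ tails S μ ↔ ν.deg ≠ 0 ∧ ∃ h : μ.src = ν.rng, μ.comp ν h ∈ S := by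
  simp [tails, tailSet]

/-- Saturation makes the tails depend only on the degree and source of a path in `S`. This is why
the gap projections can serve a whole block of matrix units. -/
theorem tails_eq {S : Finset Λ.Path} (hS : IsSaturated (S : Set Λ.Path)) {μ ν : Λ.Path}
    (hμ : μ ∈ S) (hν : ν ∈ S) (hd : μ.deg = ν.deg) (hs : μ.src = ν.src) :
    tails S μ = tails S ν := by
  have : tailSet (S : Set Λ.Path) μ = tailSet (S : Set Λ.Path) ν := by
    ext α
    constructor
    · rintro ⟨h1, h, h2⟩
      exact ⟨h1, hs.symm.trans h, hS.comp_mem hν hμ hd.symm hs.symm h _ h2⟩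
    · rintro ⟨h1, h, h2⟩
      exact ⟨h1, hs.trans h, hS.comp_mem hμ hν hd hs h _ h2⟩
  simp only [tails, this]

/-- The product of the projections `t_v - t_ν t_ν^*`, where `v = s(μ)` and `ν` runs through the
paths of nonzero degree with `μν ∈ S`. -/
noncomputable def tailGap (t : Λ.Path → A) (S : Finset Λ.Path) (μ : Λ.Path) : A :=
  gap t μ.src (tails S μ)

theorem tailGap_eq {S : Finset Λ.Path} (hS : IsSaturated (S : Set Λ.Path)) {μ ν : Λ.Path}
    (hμ : μ ∈ S) (hν : ν ∈ S) (hd : μ.deg = ν.deg) (hs : μ.src = ν.src) :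
    tailGap t S μ = tailGap t S ν := by
  rw [tailGap, tailGap, tails_eq hS hμ hν hd hs, hs]

/-- The matrix units `t_μ (∏ (t_v - t_ν t_ν^*)) t_μ'^*` of the finite-dimensional algebra attached
to a finite saturated set. -/
noncomputable def matUnit (t : Λ.Path → A) (S : Finset Λ.Path) (μ μ' : Λ.Path) : A :=
  t μ * tailGap t S μ * star (t μ')

/-- In $t_\tau^*t_\mu=\sum t_\alpha t_\beta^*$ each $\mu\beta=\tau\alpha$ lies in `S` by saturation,
and $\beta$ has nonzero degree because $\tau$ is not an initial segment of $\mu$. So $\beta$ is a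
tail of $\mu$, and $t_\beta^*$ annihilates the gap. -/
theorem star_mul_tailGap_eq_zero (hΛ : Λ.FinitelyAligned) (ht : Λ.IsCuntzKrieger t)
    {S : Finset Λ.Path} (hS : IsSaturated (S : Set Λ.Path)) {τ μ : Λ.Path} (hτ : τ ∈ S)
    (hμ : μ ∈ S) (h : ¬ τ.Prefix μ) : star (t τ) * (t μ * tailGap t S μ) = 0 := by
  rw [← mul_assoc, ht.star_mul_eq_sum hΛ, Finset.sum_mul]
  refine Finset.sum_eq_zero fun p hp => ?_
  rw [Set.Finite.mem_toFinset] at hp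
  obtain ⟨α, β⟩ := p
  obtain ⟨h1, h2, h3, -⟩ := id hp
  dsimp only at h1 h2 h3
  have h4 : μ.comp β h2 ∈ (S : Set Λ.Path) := by
    rw [← h3]
    exact hS τ hτ τ hτ μ hμ rfl rfl _ hp h1
  rw [mul_assoc, tailGap, star_mul_gap_eq_zero hΛ ht h2.symm, mul_zero]
  rw [mem_tails]
  refine ⟨fun h5 => h ?_, h2, h4⟩
  rw [← comp_eq_left h2 h5, ← h3]
  exact prefix_comp _ _ _

open Classical in
/-- The range projection `t_μ t_μ^*`, for `μ` in a finite saturated set, is the sum of the diagonal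
matrix units of the extensions of `μ`. -/
theorem range_eq_sum_matUnit (hΛ : Λ.FinitelyAligned) (ht : Λ.IsCuntzKrieger t)
    {S : Finset Λ.Path} (hS : IsSaturated (S : Set Λ.Path)) {μ : Λ.Path} (hμ : μ ∈ S) :
    t μ * star (t μ) = ∑ κ ∈ S with μ.Prefix κ, matUnit t S κ κ := by
  induction hn : (S.filter fun κ => μ.Prefix κ).card using Nat.strong_induction_on
    generalizing μ with
  | _ n ih =>
  have hrefl : μ.Prefix μ := ⟨_, rfl, comp_vertex μ rfl⟩
  have hmem : μ ∈ S.filter fun κ => μ.Prefix κ := Finset.mem_filter.2 ⟨hμ, hrefl⟩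
  rw [← Finset.add_sum_erase _ _ hmem]
  set R := ∑ κ ∈ (S.filter fun κ => μ.Prefix κ).erase μ, matUnit t S κ κ with hR
  have hext : ∀ κ ∈ (S.filter fun κ => μ.Prefix κ).erase μ,
      ∃ (β : Λ.Path) (h : μ.src = β.rng), β ∈ tails S μ ∧ μ.comp β h = κ := by
    intro κ hκ
    obtain ⟨h1, h2⟩ := Finset.mem_erase.1 hκ
    obtain ⟨h2, β, h, rfl⟩ := Finset.mem_filter.1 h2
    exact ⟨β, h, mem_tails.2 ⟨fun h3 => h1 (comp_eq_left h h3), h, h2⟩, rfl⟩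
  -- By induction, the matrix units of the extensions of $\mu\beta$ sum to its range projection, and
  -- $t_{\mu\beta}^*$ kills the other summands of `R`. Hence $t_{\mu\beta}^*R=t_{\mu\beta}^*$.
  have hYR : ∀ β ∈ tails S μ, star (t β) * (star (t μ) * (t μ * star (t μ) - R)) = 0 := by
    intro β hβ
    obtain ⟨h1, h, h2⟩ := mem_tails.1 hβ
    have hne : ¬ (μ.comp β h).Prefix μ := fun h3 => h1 (by
      have := h3.deg_le
      rw [Path.deg_comp] at this
      funext i
      have := this i
      simp only [Pi.add_apply] at this
      change β.deg i = 0
      omega)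
    have hsub : (S.filter fun κ => (μ.comp β h).Prefix κ) ⊆
        (S.filter fun κ => μ.Prefix κ).erase μ := by
      intro κ hκ
      obtain ⟨h3, h4⟩ := Finset.mem_filter.1 hκ
      refine Finset.mem_erase.2 ⟨?_, Finset.mem_filter.2 ⟨h3, (prefix_comp _ _ _).trans h4⟩⟩
      rintro rfl
      exact hne h4
    have hlt : (S.filter fun κ => (μ.comp β h).Prefix κ).card < n := by
      rw [← hn]
      exact (Finset.card_le_card hsub).trans_lt (Finset.card_erase_lt_of_mem hmem)
    have hR' : star (t (μ.comp β h)) * R = star (t (μ.comp β h)) := by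
      rw [hR, ← Finset.sum_sdiff hsub, ← ih _ hlt h2 rfl, mul_add, ht.star_mul_mul_star,
        Finset.mul_sum, Finset.sum_eq_zero, zero_add]
      intro κ hκ
      obtain ⟨h3, h4⟩ := Finset.mem_sdiff.1 hκ
      have h5 := (Finset.mem_filter.1 (Finset.mem_erase.1 h3).2).1
      rw [matUnit, ← mul_assoc, star_mul_tailGap_eq_zero hΛ ht hS h2 h5, zero_mul]
      exact fun h6 => h4 (Finset.mem_filter.2 ⟨h5, h6⟩)
    rw [← mul_assoc, ← ht.star_comp _ _ h, mul_sub, hR', ← mul_assoc, ht.star_comp_mul,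
      ← ht.star_comp _ _ h, sub_self]
  -- The diagonal matrix unit times $t_\mu t_\mu^*-R$ is computed twice. Here the gap acts as the
  -- identity, by `hYR`.
  have h1 : matUnit t S μ μ * (t μ * star (t μ) - R) = t μ * star (t μ) - R := by
    rw [matUnit, mul_assoc, mul_assoc, tailGap,
      gap_mul_eq_self (by rw [← mul_assoc, ht.vertex_mul_star μ rfl]) hYR, ← mul_assoc,
      mul_sub, ← mul_assoc, ht.partial_isometry, hR, Finset.mul_sum]
    congr 1
    refine Finset.sum_congr rfl fun κ hκ => ?_
    obtain ⟨β, h, -, rfl⟩ := hext κ hκ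
    rw [matUnit, ← mul_assoc, ← mul_assoc, ← ht.mul_eq _ _ h, ← mul_assoc, ht.partial_isometry]
  -- For the second evaluation, the gap annihilates `R`, whose summands all begin with
  -- $t_{\mu\beta}$ for a tail $\beta$.
  have h2 : matUnit t S μ μ * (t μ * star (t μ) - R) = matUnit t S μ μ := by
    have h3 : matUnit t S μ μ * R = 0 := by
      rw [hR, Finset.mul_sum]
      refine Finset.sum_eq_zero fun κ hκ => ?_
      obtain ⟨β, h, hβ, rfl⟩ := hext κ hκ
      rw [matUnit, matUnit, mul_assoc, mul_assoc (t (μ.comp β h)), ← mul_assoc (star (t μ)),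
        ht.star_mul_comp, mul_assoc (t μ), ← mul_assoc (tailGap t S μ), tailGap,
        gap_mul_eq_zero hΛ ht h.symm hβ, zero_mul, mul_zero]
    rw [mul_sub, h3, sub_zero, matUnit, mul_assoc, ht.star_mul_mul_star]
  rw [← h2, h1, sub_add_cancel]

/-- Multiply by the decomposition of $t_\mu t_\mu^*$: the summand of $\mu\beta$ turns $t_\mu
t_\nu^*$ into the matrix unit of $(\mu\beta,\nu\beta)$. -/
theorem mul_star_mem_span_matUnit (hΛ : Λ.FinitelyAligned) (ht : Λ.IsCuntzKrieger t)
    {S : Finset Λ.Path} (hS : IsSaturated (S : Set Λ.Path)) {μ ν : Λ.Path} (hμ : μ ∈ S)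
    (hν : ν ∈ S) (hd : μ.deg = ν.deg) (hs : μ.src = ν.src) :
    t μ * star (t ν) ∈ Submodule.span ℂ {a | ∃ σ ∈ S, ∃ σ' ∈ S, σ.deg = σ'.deg ∧
      σ.src = σ'.src ∧ matUnit t S σ σ' = a} := by
  classical
  have e : t μ * star (t ν) = ∑ κ ∈ S with μ.Prefix κ, matUnit t S κ κ * (t μ * star (t ν)) := by
    rw [← Finset.sum_mul, ← range_eq_sum_matUnit hΛ ht hS hμ, ← mul_assoc, ht.partial_isometry]
  rw [e]
  refine Submodule.sum_mem _ fun κ hκ => Submodule.subset_span ?_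
  obtain ⟨h1, β, h, rfl⟩ := Finset.mem_filter.1 hκ
  refine ⟨_, h1, ν.comp β (hs.symm.trans h), hS.comp_mem hν hμ hd.symm hs.symm h _ h1, ?_, rfl, ?_⟩
  · rw [Path.deg_comp, Path.deg_comp, hd]
  · rw [matUnit, matUnit, mul_assoc _ (star _) (_ * _), ← mul_assoc (star _) (t μ),
      ht.star_comp_mul, ht.star_comp ν]

end CuntzKrieger

/-! ### Boundary paths and separation by condition (B) -/

section BoundaryPaths

variable {k : ℕ} {Λ : KGraph.{u} k}

theorem Path.Prefix.comp_left {μ α β : Λ.Path} (hαβ : α.Prefix β) (h : μ.src = α.rng)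
    (h' : μ.src = β.rng) : (μ.comp α h).Prefix (μ.comp β h') := by
  obtain ⟨γ, hγ, rfl⟩ := hαβ
  exact ⟨γ, hγ, comp_assoc _ _ _ _ _⟩

namespace GenPath

/-- The path `x(p, q)`. -/
abbrev segPath (x : Λ.GenPath) (p q : OmegaObj x.deg) (h : p.val ≤ q.val) : Λ.Path :=
  ⟨x.vert q, x.vert p, x.seg p q h⟩

/-- The path `x(0, p)`. -/
abbrev initial (x : Λ.GenPath) (p : OmegaObj x.deg) : Λ.Path :=
  x.segPath (origin x.deg) p (origin_le p)

theorem deg_initial (x : Λ.GenPath) (p : OmegaObj x.deg) : (x.initial p).deg = p.val :=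
  (x.deg_seg _ _ _).trans (tsub_zero _)

theorem initial_comp_segPath (x : Λ.GenPath) (p q : OmegaObj x.deg) (h : p.val ≤ q.val) :
    (x.initial p).comp (x.segPath p q h) rfl = x.initial q :=
  (comp_eq_mk _ _).trans (congrArg (Path.mk _ _) (x.seg_comp_seg _ _ _ _ _))

theorem initial_prefix (x : Λ.GenPath) {p q : OmegaObj x.deg} (h : p.val ≤ q.val) :
    (x.initial p).Prefix (x.initial q) := ⟨_, rfl, x.initial_comp_segPath p q h⟩

/-- A graph morphism `x` is determined by its degree and the paths `x(0, q)`. -/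
theorem ext_initial {x y : Λ.GenPath} (hd : x.deg = y.deg)
    (h : ∀ (q : OmegaObj x.deg) (q' : OmegaObj y.deg), q.val = q'.val →
      x.initial q = y.initial q') : x = y := by
  obtain ⟨m, F⟩ := x
  obtain ⟨m', G⟩ := y
  dsimp only at hd
  subst hd
  congr 1
  obtain ⟨F, hF⟩ := F
  obtain ⟨G, hG⟩ := G
  congr 1
  refine Functor.hext (fun q => congrArg Path.src (h q q rfl)) fun q p f => ?_
  have h1 := initial_comp_segPath (⟨m, ⟨F, hF⟩⟩ : Λ.GenPath) p q f.down
  have h2 := initial_comp_segPath (⟨m, ⟨G, hG⟩⟩ : Λ.GenPath) p q f.down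
  rw [h q q rfl, ← h2] at h1
  have h3 := (comp_inj h1 (by rw [h p p rfl])).2
  exact (Path.mk.inj h3).2.2

end GenPath

theorem mk_comp_eq_of_deg {a b c : Λ.Obj} (g : a ⟶ b) (e : b ⟶ c) (he : Λ.deg e = 0) :
    (⟨a, c, g ≫ e⟩ : Λ.Path) = ⟨a, b, g⟩ := by
  have h := eq_vertex_of_deg (μ := (⟨b, c, e⟩ : Λ.Path)) he
  obtain ⟨rfl, h1, h2⟩ := Path.mk.inj h
  have h3 : e = 𝟙 b := eq_of_heq h2
  rw [h3, Category.comp_id]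

theorem initial_concat_prefix (x : Λ.GenPath) (μ : Λ.Path) (h : μ.src = x.rng)
    (q : OmegaObj (x.concat μ h).deg) :
    ((x.concat μ h).initial q).Prefix (μ.comp (x.initial (shift μ x q)) h) := by
  -- The segment $(0,q)$ of the concatenation ends at the vertex given by the segment of degree $0$,
  -- which is `μ.rng` only up to a morphism of degree zero. Equality of bundled paths absorbs this
  -- morphism.
  have h1 : (⟨_, μ.rng, (concatInitial μ x h q).2⟩ : Λ.Path) = (x.concat μ h).initial q := by
    have h2 := (concatInitial_coherent μ x h (GenPath.origin _) q
      (GenPath.origin_le q)).choose_spec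
    rw [← h2]
    exact mk_comp_eq_of_deg _ _ (concatInitial_spec μ x h (GenPath.origin _)).1
  obtain ⟨-, τ, hτ⟩ := concatInitial_spec μ x h q
  rw [← h1]
  refine ⟨⟨_, _, τ⟩, rfl, ?_⟩
  rw [comp_eq_mk, hτ]
  rfl

/-- The largest element of `ℕ^k` below `m` in the coordinates where `m` is finite, and `n`
elsewhere. -/
noncomputable def capObj (m : Fin k → ℕ∞) (n : Fin k → ℕ) : OmegaObj m :=
  ⟨fun i => if m i = ⊤ then n i else (m i).toNat, fun i => by
    split_ifs with h
    · rw [h]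
      exact le_top
    · exact ENat.natCast_toNat_le_self _⟩

theorem le_capObj {m : Fin k → ℕ∞} {n p : Fin k → ℕ} (hp : ∀ i, (p i : ℕ∞) ≤ m i) (h : p ≤ n) :
    p ≤ (capObj m n).val := by
  intro i
  dsimp only [capObj]
  split_ifs with hi
  · exact h i
  · have h1 := hp i
    rw [← ENat.natCast_toNat hi] at h1
    exact_mod_cast h1

/-- If $d(\nu)_i>d(\mu)_i$, a minimal common extension must lengthen $\mu x(0,p)$ in direction $i$.
When $p_i=d(x)_i$ is the end of $x$ in this direction, that yields an edge of degree $e_i$ at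
$x(p)$, which a boundary path forbids for $p\ge n_0$. -/
theorem deg_le_of_boundary {x : Λ.GenPath} {n₀ : Fin k → ℕ} (hn₀ : ∀ i, (n₀ i : ℕ∞) ≤ x.deg i)
    (hx : ∀ n : OmegaObj x.deg, n₀ ≤ n.val → ∀ i, (n.val i : ℕ∞) = x.deg i →
      ¬ ∃ μ : Λ.Path, μ.rng = x.vert n ∧ μ.deg = Pi.single i 1) {μ ν : Λ.Path}
    (hμ : μ.src = x.rng) (hν : ν.src = x.rng)
    (h : ∀ p, (Λ.Lmin (μ.comp (x.initial p) hμ) (ν.comp (x.initial p) hν)).Nonempty) {i : Fin k}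
    (hi : x.deg i ≠ ⊤) : ν.deg i ≤ μ.deg i := by
  set p := capObj x.deg n₀ with hp
  obtain ⟨⟨α, β⟩, h1, h2, h3, h4⟩ := h p
  dsimp only at h1 h2 h3 h4
  by_contra! hlt
  have h5 := congrFun h4 i
  rw [Path.deg_comp, Path.deg_comp, Path.deg_comp] at h5
  simp only [Pi.add_apply, Pi.sup_apply] at h5
  have h6 : 1 ≤ α.deg i := by omega
  obtain ⟨ε, η, h7, h8, -, h9⟩ := α.exists_factor (Pi.single i 1) (α.deg - Pi.single i 1) (by
    rw [add_tsub_cancel_of_le]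
    intro j
    rcases eq_or_ne j i with rfl | hj
    · simpa using h6
    · simp [hj])
  refine hx p (le_capObj hn₀ le_rfl) i ?_ ⟨ε, ?_, h8⟩
  · change ((if x.deg i = ⊤ then n₀ i else (x.deg i).toNat : ℕ) : ℕ∞) = _
    rw [if_neg hi, ENat.natCast_toNat hi]
  · rw [← h9] at h1
    exact h1.symm

/-- If the concatenations `μx` and `νx` with a boundary path `x` differ, then some initial segments
of them have no common extension. -/
theorem exists_disjoint_initial {x : Λ.GenPath} (hx : x.IsBoundary) {μ ν : Λ.Path}
    (hμ : μ.src = x.rng) (hν : ν.src = x.rng) (hne : x.concat μ hμ ≠ x.concat ν hν) :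
    ∃ p, ¬ (Λ.Lmin (μ.comp (x.initial p) hμ) (ν.comp (x.initial p) hν)).Nonempty := by
  by_contra! h
  obtain ⟨n₀, hn₀, hx⟩ := hx
  have h' : ∀ p, (Λ.Lmin (ν.comp (x.initial p) hν) (μ.comp (x.initial p) hμ)).Nonempty :=
    fun p => by
      rw [Lmin_swap]
      exact (h p).image _
  have hd : (x.concat μ hμ).deg = (x.concat ν hν).deg := by
    funext i
    change x.deg i + μ.deg i = x.deg i + ν.deg i
    by_cases hi : x.deg i = ⊤
    · rw [hi, top_add, top_add]
    · rw [le_antisymm (deg_le_of_boundary hn₀ hx hν hμ h' hi)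
        (deg_le_of_boundary hn₀ hx hμ hν h hi)]
  refine hne (GenPath.ext_initial hd fun q q' hq => ?_)
  -- Capping `q.val` at the finite coordinates of $d(x)$ gives a position in $x$ beyond the shifts
  -- of $q$ by both $d(\mu)$ and $d(\nu)$. So both segments of degree $q$ are initial segments of
  -- the same path $\kappa$.
  obtain ⟨κ, hκ, hκ'⟩ := Lmin_nonempty_iff.1 (h (capObj x.deg q.val))
  have extend : ∀ {ξ : Λ.Path} (hξ : ξ.src = x.rng) {r r' : OmegaObj x.deg} (_ : r.val ≤ r'.val),
      (ξ.comp (x.initial r) hξ).Prefix (ξ.comp (x.initial r') hξ) := by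
    intro ξ hξ r r' hr
    exact (x.initial_prefix hr).comp_left hξ hξ
  refine Prefix.eq_of_deg (κ := κ) (((initial_concat_prefix x μ hμ q).trans
    (extend hμ (le_capObj (shift μ x q).le ?_))).trans hκ)
    (((initial_concat_prefix x ν hν q').trans
      (extend hν (le_capObj (shift ν x q').le ?_))).trans hκ') ?_
  · exact tsub_le_self
  · rw [hq]
    exact tsub_le_self
  · rw [GenPath.deg_initial, GenPath.deg_initial, hq]

/-- Condition (B) provides, for finitely many pairs of distinct paths with source `v`, a path `ρ`
such that for each pair `(μ, ν)` the paths `μρ` and `νρ` have no common extension. -/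
theorem ConditionB.exists_separating (hB : Λ.ConditionB) (v : Λ.Obj)
    (D : Finset (Λ.Path × Λ.Path)) (hD : ∀ d ∈ D, d.1.src = v ∧ d.2.src = v ∧ d.1 ≠ d.2) :
    ∃ ρ : Λ.Path, ρ.rng = v ∧ ∀ d ∈ D, ∀ (h : d.1.src = ρ.rng) (h' : d.2.src = ρ.rng),
      ¬ (Λ.Lmin (d.1.comp ρ h) (d.2.comp ρ h')).Nonempty := by
  classical
  obtain ⟨x, hx, rfl, hap⟩ := hB v
  suffices H : ∃ p, ∀ d ∈ D, ∀ (h : d.1.src = x.rng) (h' : d.2.src = x.rng),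
      ¬ (Λ.Lmin (d.1.comp (x.initial p) h) (d.2.comp (x.initial p) h')).Nonempty by
    obtain ⟨p, hp⟩ := H
    exact ⟨x.initial p, rfl, hp⟩
  have mono : ∀ {μ ν : Λ.Path} (h : μ.src = x.rng) (h' : ν.src = x.rng) (p q : OmegaObj x.deg),
      p.val ≤ q.val → (Λ.Lmin (μ.comp (x.initial q) h) (ν.comp (x.initial q) h')).Nonempty →
      (Λ.Lmin (μ.comp (x.initial p) h) (ν.comp (x.initial p) h')).Nonempty := by
    intro μ ν h h' p q hpq hne
    obtain ⟨κ, h1, h2⟩ := Lmin_nonempty_iff.1 hne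
    exact Lmin_nonempty_iff.2 ⟨κ, ((x.initial_prefix hpq).comp_left h h).trans h1,
      ((x.initial_prefix hpq).comp_left h' h').trans h2⟩
  induction D using Finset.induction_on with
  | empty => exact ⟨GenPath.origin _, by simp⟩
  | insert d D _ ih =>
    obtain ⟨p, hp⟩ := ih fun e he => hD e (Finset.mem_insert_of_mem he)
    obtain ⟨h1, h2, h3⟩ := hD d (Finset.mem_insert_self _ _)
    obtain ⟨q, hq⟩ := exists_disjoint_initial hx h1 h2 (hap _ _ h1 h2 h3)
    -- Lacking a common extension persists when the initial segments are lengthened, so the join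
    -- serves the new pair and the old ones.
    let r : OmegaObj x.deg := ⟨p.val ⊔ q.val, fun i => by
      rcases le_total (p.val i) (q.val i) with h | h
      · rw [Pi.sup_apply, sup_eq_right.2 h]
        exact q.le i
      · rw [Pi.sup_apply, sup_eq_left.2 h]
        exact p.le i⟩
    refine ⟨r, fun e he h h' hne => ?_⟩
    rcases Finset.mem_insert.1 he with rfl | he
    · exact hq (mono h1 h2 q r le_sup_right hne)
    · exact hp e he h h' (mono h h' p r le_sup_left hne)

end BoundaryPaths

/-! ### Corners attached to blocks -/

section Corner

variable {k : ℕ} {Λ : KGraph.{u} k}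

/-- The path `ρ` has range `s(μ)` and no common extension with the paths `ν` of nonzero degree such
that `μν ∈ S`. -/
def Avoids (S : Finset Λ.Path) (μ ρ : Λ.Path) : Prop :=
  μ.src = ρ.rng ∧ ∀ ν ∈ tails S μ, ¬ (Λ.Lmin ν ρ).Nonempty

theorem Avoids.congr {S : Finset Λ.Path} (hS : IsSaturated (S : Set Λ.Path)) {μ ν ρ : Λ.Path}
    (h : Avoids S μ ρ) (hμ : μ ∈ S) (hν : ν ∈ S) (hd : ν.deg = μ.deg) (hs : ν.src = μ.src) :
    Avoids S ν ρ :=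
  ⟨hs.trans h.1, by rw [tails_eq hS hν hμ hd hs]; exact h.2⟩

/-- A common extension of $\mu\rho$ and $\nu$ would pass through a minimal common extension $\mu\xi$
of $\mu$ and $\nu$. It lies in `S`, and $\xi$ has nonzero degree since $\nu$ is not an initial
segment of $\mu$; so $\xi$ would be a tail meeting $\rho$. -/
theorem Avoids.not_nonempty {S : Finset Λ.Path} (hS : IsSaturated (S : Set Λ.Path))
    {μ ν ρ : Λ.Path} (h : Avoids S μ ρ) (hμ : μ ∈ S) (hν : ν ∈ S) (hνμ : ¬ ν.Prefix μ) :
    ¬ (Λ.Lmin (μ.comp ρ h.1) ν).Nonempty := by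
  rintro ⟨⟨α, β⟩, h1, h2, h3, -⟩
  dsimp only at h1 h2 h3
  have h4 : μ.comp (ρ.comp α h1) h.1 = ν.comp β h2 := (comp_assoc _ _ _ h.1 _).symm.trans h3
  obtain ⟨ξ, ξ', ζ, k1, k2, k3, k4, -⟩ := exists_Lmin_factor h4
  obtain ⟨h5, h6, h7, -⟩ := id k3
  dsimp only at h5 h6 h7
  refine h.2 ξ ?_ (Lmin_nonempty_iff.2 ⟨_, ⟨ζ, k1, k4⟩, prefix_comp _ _ _⟩)
  refine mem_tails.2 ⟨fun h8 => hνμ ?_, h5, hS μ hμ μ hμ ν hν rfl rfl _ k3 h5⟩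
  rw [← comp_eq_left h5 h8, h7]
  exact prefix_comp _ _ _

variable {A : Type v} [NonUnitalCStarAlgebra A] {t : Λ.Path → A}

theorem Avoids.star_mul_eq_zero (ht : Λ.IsCuntzKrieger t)
    {S : Finset Λ.Path} (hS : IsSaturated (S : Set Λ.Path))
    {μ ν ρ : Λ.Path} (h : Avoids S μ ρ) (hμ : μ ∈ S) (hν : ν ∈ S) (hνμ : ¬ ν.Prefix μ) :
    star (t μ * t ρ) * t ν = 0 := by
  rw [ht.mul_eq _ _ h.1]
  exact ht.star_mul_eq_zero (h.not_nonempty hS hμ hν hνμ)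

theorem star_tailGap (hΛ : Λ.FinitelyAligned) (ht : Λ.IsCuntzKrieger t) (S : Finset Λ.Path)
    (μ : Λ.Path) : star (tailGap t S μ) = tailGap t S μ := by
  have key : ∀ l : List Λ.Path, (∀ ν ∈ l, ν.rng = μ.src) →
      star (gap t μ.src l) = gap t μ.src l := by
    intro l hl
    induction l with
    | nil => exact ht.star_vertex _
    | cons ν l ih =>
      have ih' := ih fun κ hκ => hl κ (List.mem_cons_of_mem _ hκ)
      have h1 := (commute_gap hΛ ht l (hl ν List.mem_cons_self)).eq
      have h2 := gap_mul_vertex ht μ.src l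
      have h3 := congrArg star h2
      rw [star_mul, ht.star_vertex, ih'] at h3
      rw [gap_cons, star_mul, ih', star_sub, star_mul, star_star, ht.star_vertex, mul_sub, sub_mul,
        h1, h2, h3]
  exact key _ fun ν hν => (mem_tails.1 hν).2.1.symm

theorem star_matUnit (hΛ : Λ.FinitelyAligned) (ht : Λ.IsCuntzKrieger t) {S : Finset Λ.Path}
    (hS : IsSaturated (S : Set Λ.Path)) {μ ν : Λ.Path} (hμ : μ ∈ S) (hν : ν ∈ S)
    (hd : μ.deg = ν.deg) (hs : μ.src = ν.src) :
    star (matUnit t S μ ν) = matUnit t S ν μ := by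
  rw [matUnit, matUnit, star_mul, star_mul, star_star, star_tailGap hΛ ht,
    tailGap_eq hS hμ hν hd hs, mul_assoc]

theorem Avoids.tailGap_mul (ht : Λ.IsCuntzKrieger t) {S : Finset Λ.Path} {μ ρ : Λ.Path}
    (h : Avoids S μ ρ) : tailGap t S μ * t ρ = t ρ :=
  gap_mul_eq_self (ht.vertex_mul ρ h.1) fun ν hν => ht.star_mul_eq_zero (h.2 ν hν)

theorem Avoids.star_mul_matUnit (hΛ : Λ.FinitelyAligned) (ht : Λ.IsCuntzKrieger t)
    {S : Finset Λ.Path} {μ ρ : Λ.Path} (h : Avoids S μ ρ) (ν : Λ.Path) :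
    star (t μ * t ρ) * matUnit t S μ ν = star (t ν * t ρ) := by
  have h1 := congrArg star (h.tailGap_mul ht)
  rw [star_mul, star_tailGap hΛ ht] at h1
  have h2 : t (Λ.vertex μ.src) * tailGap t S μ = tailGap t S μ := by
    have := congrArg star (gap_mul_vertex ht μ.src (tails S μ))
    rwa [star_mul, ht.star_vertex, ← tailGap, star_tailGap hΛ ht] at this
  rw [star_mul, star_mul, matUnit, mul_assoc, ← mul_assoc (star (t μ)), ← mul_assoc (star (t μ)),
    ht.star_mul_self, h2, ← mul_assoc, h1]

/-- If $\mu=\kappa\beta$ properly, then $\beta$ is a tail of $\kappa$ and the gap of $\kappa$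
removes it. If $\kappa$ is not an initial segment of $\mu$, then $\mu\rho$ and $\kappa$ have no
common extension. -/
theorem Avoids.star_mul_matUnit_of_ne (hΛ : Λ.FinitelyAligned) (ht : Λ.IsCuntzKrieger t)
    {S : Finset Λ.Path} (hS : IsSaturated (S : Set Λ.Path)) {μ ρ : Λ.Path} (h : Avoids S μ ρ)
    (hμ : μ ∈ S) {κ : Λ.Path} (hκ : κ ∈ S) (hne : κ ≠ μ) (ν : Λ.Path) :
    star (t μ * t ρ) * matUnit t S κ ν = 0 := by
  by_cases hκμ : κ.Prefix μ
  · obtain ⟨β, hβ, rfl⟩ := hκμ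
    have h1 : β ∈ tails S κ := mem_tails.2 ⟨fun h2 => hne (comp_eq_left hβ h2).symm, hβ, hμ⟩
    rw [matUnit, star_mul, mul_assoc, ← mul_assoc (star (t (κ.comp β hβ))),
      ← mul_assoc (star (t (κ.comp β hβ))), ht.star_comp_mul, tailGap,
      star_mul_gap_eq_zero hΛ ht hβ.symm h1, zero_mul, mul_zero]
  · rw [matUnit, ← mul_assoc, ← mul_assoc, h.star_mul_eq_zero ht hS hμ hκ hκμ, zero_mul, zero_mul]

open Classical in
/-- The elements of `S` with the same source and degree as `μ`. -/
noncomputable def block (S : Finset Λ.Path) (μ : Λ.Path) : Finset Λ.Path :=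
  S.filter fun ν => ν.deg = μ.deg ∧ ν.src = μ.src

theorem mem_block {S : Finset Λ.Path} {μ ν : Λ.Path} :
    ν ∈ block S μ ↔ ν ∈ S ∧ ν.deg = μ.deg ∧ ν.src = μ.src := by
  simp [block]

/-- The sum of the range projections of the paths `νρ`, for the `ν ∈ S` with the same source and
degree as `μ`. -/
noncomputable def corner (t : Λ.Path → A) (S : Finset Λ.Path) (μ ρ : Λ.Path) : A :=
  ∑ ν ∈ block S μ, t ν * t ρ * star (t ν * t ρ)

theorem star_corner (S : Finset Λ.Path) (μ ρ : Λ.Path) :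
    star (corner t S μ ρ) = corner t S μ ρ := by
  rw [corner, star_sum]
  exact Finset.sum_congr rfl fun ν _ => by rw [star_mul, star_star]

theorem Avoids.block {S : Finset Λ.Path} (hS : IsSaturated (S : Set Λ.Path)) {μ ρ : Λ.Path}
    (h : Avoids S μ ρ) (hμ : μ ∈ S) {ν : Λ.Path} (hν : ν ∈ block S μ) : Avoids S ν ρ :=
  h.congr hS hμ (mem_block.1 hν).1 (mem_block.1 hν).2.1 (mem_block.1 hν).2.2

theorem Avoids.star_mul_of_ne (ht : Λ.IsCuntzKrieger t) {S : Finset Λ.Path}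
    (hS : IsSaturated (S : Set Λ.Path)) {μ ρ : Λ.Path} (h : Avoids S μ ρ) (hμ : μ ∈ S)
    {ν κ : Λ.Path} (hν : ν ∈ KGraph.block S μ) (hκ : κ ∈ KGraph.block S μ) (hne : κ ≠ ν) :
    star (t ν * t ρ) * (t κ * t ρ) = 0 := by
  have hν' := mem_block.1 hν
  have hκ' := mem_block.1 hκ
  rw [← mul_assoc, (h.block hS hμ hν).star_mul_eq_zero ht hS hν'.1 hκ'.1 fun h1 => hne ?_, zero_mul]
  exact h1.eq_of_deg ⟨_, rfl, comp_vertex ν rfl⟩ (hκ'.2.1.trans hν'.2.1.symm)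

theorem Avoids.star_mul_self (ht : Λ.IsCuntzKrieger t) {S : Finset Λ.Path} {μ ρ : Λ.Path}
    (h : Avoids S μ ρ) : star (t μ * t ρ) * (t μ * t ρ) = t (Λ.vertex ρ.src) := by
  rw [star_mul, mul_assoc, ← mul_assoc (star (t μ)), ht.star_mul_self, ht.vertex_mul ρ h.1,
    ht.star_mul_self]

theorem Avoids.star_mul_corner (ht : Λ.IsCuntzKrieger t) {S : Finset Λ.Path}
    (hS : IsSaturated (S : Set Λ.Path)) {μ ρ : Λ.Path} (h : Avoids S μ ρ) (hμ : μ ∈ S)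
    {ν : Λ.Path} (hν : ν ∈ KGraph.block S μ) :
    star (t ν * t ρ) * corner t S μ ρ = star (t ν * t ρ) := by
  rw [corner, Finset.mul_sum, Finset.sum_eq_single_of_mem ν hν]
  · rw [← mul_assoc, (h.block hS hμ hν).star_mul_self ht, star_mul, ← mul_assoc,
      ht.vertex_mul_star ρ rfl]
  · intro κ hκ hne
    rw [← mul_assoc, h.star_mul_of_ne ht hS hμ hν hκ hne, zero_mul]

theorem Avoids.corner_mul_corner (ht : Λ.IsCuntzKrieger t) {S : Finset Λ.Path}
    (hS : IsSaturated (S : Set Λ.Path)) {μ ρ : Λ.Path} (h : Avoids S μ ρ) (hμ : μ ∈ S) :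
    corner t S μ ρ * corner t S μ ρ = corner t S μ ρ := by
  conv_lhs => enter [1]; rw [corner]
  rw [Finset.sum_mul]
  refine Finset.sum_congr rfl fun ν hν => ?_
  rw [mul_assoc, h.star_mul_corner ht hS hμ hν]

open Classical in
theorem Avoids.corner_mul_matUnit (hΛ : Λ.FinitelyAligned) (ht : Λ.IsCuntzKrieger t)
    {S : Finset Λ.Path} (hS : IsSaturated (S : Set Λ.Path)) {μ ρ : Λ.Path} (h : Avoids S μ ρ)
    (hμ : μ ∈ S) {ν : Λ.Path} (hν : ν ∈ S) (ν' : Λ.Path) :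
    corner t S μ ρ * matUnit t S ν ν' =
      if ν ∈ KGraph.block S μ then t ν * t ρ * star (t ν' * t ρ) else 0 := by
  rw [corner, Finset.sum_mul]
  split_ifs with h1
  · rw [Finset.sum_eq_single_of_mem ν h1, mul_assoc,
      (h.block hS hμ h1).star_mul_matUnit hΛ ht]
    intro κ hκ hne
    rw [mul_assoc, (h.block hS hμ hκ).star_mul_matUnit_of_ne hΛ ht hS (mem_block.1 hκ).1 hν
      hne.symm, mul_zero]
  · refine Finset.sum_eq_zero fun κ hκ => ?_
    rw [mul_assoc, (h.block hS hμ hκ).star_mul_matUnit_of_ne hΛ ht hS (mem_block.1 hκ).1 hν,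
      mul_zero]
    rintro rfl
    exact h1 hκ

/-- The formula for the corner times a matrix unit is symmetric under adjoints, because $\nu$ and
$\nu'$ lie in the same block. -/
theorem Avoids.commute_corner_matUnit (hΛ : Λ.FinitelyAligned) (ht : Λ.IsCuntzKrieger t)
    {S : Finset Λ.Path} (hS : IsSaturated (S : Set Λ.Path)) {μ ρ : Λ.Path} (h : Avoids S μ ρ)
    (hμ : μ ∈ S) {ν ν' : Λ.Path} (hν : ν ∈ S) (hν' : ν' ∈ S) (hd : ν.deg = ν'.deg)
    (hs : ν.src = ν'.src) : Commute (corner t S μ ρ) (matUnit t S ν ν') := by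
  classical
  have h1 := congrArg star (h.corner_mul_matUnit hΛ ht hS hμ hν' ν)
  rw [star_mul, star_corner, star_matUnit hΛ ht hS hν' hν hd.symm hs.symm] at h1
  have h2 : ν' ∈ KGraph.block S μ ↔ ν ∈ KGraph.block S μ := by
    rw [mem_block, mem_block, hd, hs]
    tauto
  rw [Commute, SemiconjBy, h1, h.corner_mul_matUnit hΛ ht hS hμ hν ν']
  simp only [h2]
  split_ifs
  · rw [star_mul (t ν' * t ρ), star_star]
  · rw [star_zero]

/-- If `ρ` also separates the paths `β`, then the corner compresses the elements `t_κ t_ν^*` with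
`d(κ) ≠ d(ν)` to zero. -/
theorem Avoids.corner_mul_mul_corner (ht : Λ.IsCuntzKrieger t) {S : Finset Λ.Path}
    (hS : IsSaturated (S : Set Λ.Path)) {μ ρ : Λ.Path} (h : Avoids S μ ρ) (hμ : μ ∈ S)
    (hsep : ∀ (κ β ν β' : Λ.Path) (_ : κ ∈ S) (_ : ν ∈ S) (h₁ : κ.src = β.rng)
      (h₂ : ν.src = β'.rng), κ.comp β h₁ ∈ S → ν.comp β' h₂ ∈ S → β.deg ≠ β'.deg →
      ∀ (h₃ : β.src = ρ.rng) (h₄ : β'.src = ρ.rng),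
        ¬ (Λ.Lmin (β.comp ρ h₃) (β'.comp ρ h₄)).Nonempty)
    {κ ν : Λ.Path} (hκ : κ ∈ S) (hν : ν ∈ S) (hd : κ.deg ≠ ν.deg) :
    corner t S μ ρ * (t κ * star (t ν)) * corner t S μ ρ = 0 := by
  rw [corner, Finset.sum_mul, Finset.sum_mul]
  refine Finset.sum_eq_zero fun σ hσ => ?_
  rw [Finset.mul_sum]
  refine Finset.sum_eq_zero fun σ' hσ' => ?_
  -- Only $\sigma=\kappa\beta$ and $\sigma'=\nu\beta'$ can contribute, and then the middle factor is
  -- $t_{\beta\rho}^*t_{\beta'\rho}$.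
  suffices H : star (t σ * t ρ) * t κ * (star (t ν) * (t σ' * t ρ)) = 0 by
    calc _ = t σ * t ρ * (star (t σ * t ρ) * t κ * (star (t ν) * (t σ' * t ρ))) *
          star (t σ' * t ρ) := by simp only [mul_assoc]
      _ = 0 := by rw [H, mul_zero, zero_mul]
  have a := h.block hS hμ hσ
  have a' := h.block hS hμ hσ'
  rw [mem_block] at hσ hσ'
  by_cases h1 : κ.Prefix σ
  swap
  · rw [a.star_mul_eq_zero ht hS hσ.1 hκ h1, zero_mul]
  by_cases h2 : ν.Prefix σ'
  swap
  · have h3 := congrArg star (a'.star_mul_eq_zero ht hS hσ'.1 hν h2)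
    rw [star_mul, star_star, star_zero] at h3
    rw [h3, mul_zero]
  obtain ⟨β, hβ, rfl⟩ := h1
  obtain ⟨β', hβ', rfl⟩ := h2
  have h3 : star (t (κ.comp β hβ) * t ρ) * t κ = star (t β * t ρ) := by
    rw [star_mul, mul_assoc, ht.star_comp_mul, star_mul]
  have h4 : star (t ν) * (t (ν.comp β' hβ') * t ρ) = t β' * t ρ := by
    rw [← mul_assoc, ht.star_mul_comp]
  have h5 : β.src = ρ.rng := a.1
  have h6 : β'.src = ρ.rng := a'.1
  rw [h3, h4, ht.mul_eq _ _ h5, ht.mul_eq _ _ h6]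
  -- As $\sigma$ and $\sigma'$ have equal degree, $d(\kappa)\ne d(\nu)$ forces $d(\beta)\ne
  -- d(\beta')$.
  refine ht.star_mul_eq_zero (hsep κ β ν β' hκ hν hβ hβ' hσ.1 hσ'.1 (fun h7 => hd ?_) h5 h6)
  have h8 := hσ.2.1.trans hσ'.2.1.symm
  rw [Path.deg_comp, Path.deg_comp, h7] at h8
  exact add_right_cancel h8

/-- For `μ ∈ S` such that the paths `ν` of nonzero degree with `μν ∈ S` are not exhaustive, condition
(B) provides a path that defines a corner as above. -/
theorem ConditionB.exists_avoids (hB : Λ.ConditionB) (S : Finset Λ.Path) {μ : Λ.Path}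
    (hex : ¬ Λ.Exhaustive μ.src {ν | ν ∈ tails S μ}) :
    ∃ ρ, Avoids S μ ρ ∧ ∀ (κ β ν β' : Λ.Path) (_ : κ ∈ S) (_ : ν ∈ S) (h₁ : κ.src = β.rng)
      (h₂ : ν.src = β'.rng), κ.comp β h₁ ∈ S → ν.comp β' h₂ ∈ S → β.deg ≠ β'.deg →
      ∀ (h₃ : β.src = ρ.rng) (h₄ : β'.src = ρ.rng),
        ¬ (Λ.Lmin (β.comp ρ h₃) (β'.comp ρ h₄)).Nonempty := by
  obtain ⟨τ, hτ, hτ'⟩ : ∃ τ : Λ.Path, τ.rng = μ.src ∧ ∀ ν ∈ tails S μ,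
      ¬ (Λ.Lmin ν τ).Nonempty := by
    by_contra! h
    refine hex ⟨fun ν hν => (mem_tails.1 hν).2.1.symm, fun τ hτ => ?_⟩
    exact h τ hτ
  -- All final segments that can occur, including the trivial ones. There are finitely many, so
  -- condition (B) can separate all relevant pairs by one path.
  set F : Set Λ.Path := ⋃ κ ∈ S, insert (Λ.vertex κ.src) (tailSet (S : Set Λ.Path) κ) with hF
  have hFfin : F.Finite := S.finite_toSet.biUnion fun κ _ =>
    (finite_tailSet S.finite_toSet κ).insert _
  have hFmem : ∀ (κ β : Λ.Path) (_ : κ ∈ S) (h : κ.src = β.rng), κ.comp β h ∈ S → β ∈ F := by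
    intro κ β hκ h hβ
    refine Set.mem_biUnion hκ ?_
    by_cases h0 : β.deg = 0
    · left
      rw [eq_vertex_of_deg h0, h]
    · exact Or.inr ⟨h0, h, hβ⟩
  have hDfin : {d : Λ.Path × Λ.Path | ∃ β ∈ F, ∃ β' ∈ F, β.deg ≠ β'.deg ∧
      ∃ (h : β.src = τ.rng) (h' : β'.src = τ.rng), d = (β.comp τ h, β'.comp τ h')}.Finite := by
    have : (⋃ β ∈ F, ⋃ β' ∈ F, {d : Λ.Path × Λ.Path | ∃ (h : β.src = τ.rng)
        (h' : β'.src = τ.rng), d = (β.comp τ h, β'.comp τ h')}).Finite := by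
      refine hFfin.biUnion fun β _ => hFfin.biUnion fun β' _ => Set.Subsingleton.finite ?_
      rintro _ ⟨h, h', rfl⟩ _ ⟨k, k', rfl⟩
      rfl
    refine this.subset ?_
    rintro d ⟨β, hβ, β', hβ', -, h⟩
    simp only [Set.mem_iUnion]
    exact ⟨β, hβ, β', hβ', h⟩
  obtain ⟨η, hη, hsep⟩ := hB.exists_separating τ.src hDfin.toFinset (by
    intro d hd
    obtain ⟨β, -, β', -, hne, h, h', rfl⟩ := hDfin.mem_toFinset.1 hd
    refine ⟨rfl, rfl, fun e => hne ?_⟩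
    have := congrArg Path.deg e
    rw [Path.deg_comp, Path.deg_comp] at this
    exact add_right_cancel this)
  -- The first part $\tau$ misses the tails, and its extension $\eta$ separates the pairs
  -- $(\beta\tau,\beta'\tau)$; both properties pass to $\rho=\tau\eta$.
  refine ⟨τ.comp η hη.symm, ⟨hτ.symm, fun ν hν hne => hτ' ν hν ?_⟩, ?_⟩
  · obtain ⟨κ, h1, h2⟩ := Lmin_nonempty_iff.1 hne
    exact Lmin_nonempty_iff.2 ⟨κ, h1, (prefix_comp _ _ _).trans h2⟩
  · intro κ β ν β' hκ hν h₁ h₂ hβ hβ' hne h₃ h₄ hL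
    have h5 : β.src = τ.rng := h₃
    have h6 : β'.src = τ.rng := h₄
    refine hsep (β.comp τ h5, β'.comp τ h6) (hDfin.mem_toFinset.2
      ⟨β, hFmem κ β hκ h₁ hβ, β', hFmem ν β' hν h₂ hβ', hne, h5, h6, rfl⟩) hη.symm hη.symm ?_
    have e1 : (β.comp τ h5).comp η hη.symm = β.comp (τ.comp η hη.symm) h₃ := comp_assoc _ _ _ _ _
    have e2 : (β'.comp τ h6).comp η hη.symm = β'.comp (τ.comp η hη.symm) h₄ :=
      comp_assoc _ _ _ _ _
    change (Λ.Lmin ((β.comp τ h5).comp η hη.symm) ((β'.comp τ h6).comp η hη.symm)).Nonempty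
    rw [e1, e2]
    exact hL

end Corner

/-! ### The finite-dimensional core and the diagonal estimate -/

section CoreAlgebra

variable {k : ℕ} {Λ : KGraph.{u} k} {A : Type v} [NonUnitalCStarAlgebra A] {t : Λ.Path → A}

/-- The elements `t_μ t_ν^*`, where `μ, ν ∈ S` have equal source and degree. -/
def coreGenerators (t : Λ.Path → A) (S : Finset Λ.Path) : Set A :=
  {a | ∃ μ ∈ S, ∃ ν ∈ S, μ.deg = ν.deg ∧ μ.src = ν.src ∧ t μ * star (t ν) = a}

theorem finite_coreGenerators (t : Λ.Path → A) (S : Finset Λ.Path) :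
    (coreGenerators t S).Finite := by
  have := (S.finite_toSet.prod S.finite_toSet).image fun p => t p.1 * star (t p.2)
  refine this.subset ?_
  rintro _ ⟨μ, hμ, ν, hν, -, -, rfl⟩
  exact ⟨(μ, ν), ⟨hμ, hν⟩, rfl⟩

theorem mul_star_mul_mul_star (hΛ : Λ.FinitelyAligned) (ht : Λ.IsCuntzKrieger t)
    (μ ν σ τ : Λ.Path) : t μ * star (t ν) * (t σ * star (t τ)) =
      ∑ p ∈ (hΛ ν σ).toFinset, t μ * t p.1 * star (t τ * t p.2) := by
  calc _ = t μ * (star (t ν) * t σ) * star (t τ) := by simp only [mul_assoc]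
    _ = _ := by
      rw [ht.star_mul_eq_sum hΛ, Finset.mul_sum, Finset.sum_mul]
      simp only [star_mul, mul_assoc]

/-- The finite-dimensional `C^*`-algebra spanned by the elements `t_μ t_ν^*`, where `μ, ν` in the
finite saturated set `S` have equal source and degree. -/
noncomputable def coreAlgebra (hΛ : Λ.FinitelyAligned) (ht : Λ.IsCuntzKrieger t)
    {S : Finset Λ.Path} (hS : IsSaturated (S : Set Λ.Path)) : NonUnitalStarSubalgebra ℂ A where
  toSubmodule := Submodule.span ℂ (coreGenerators t S)
  mul_mem' {a b} ha hb := by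
    change a ∈ Submodule.span ℂ _ at ha
    change b ∈ Submodule.span ℂ _ at hb
    change a * b ∈ Submodule.span ℂ _
    induction ha, hb using Submodule.span_induction₂ with
    | mem_mem x y hx hy =>
      obtain ⟨μ, hμ, ν, hν, hd, hs, rfl⟩ := hx
      obtain ⟨σ, hσ, τ, hτ, hd', hs', rfl⟩ := hy
      rw [mul_star_mul_mul_star hΛ ht]
      refine Submodule.sum_mem _ fun p hp => Submodule.subset_span ?_
      have hp' := (hΛ ν σ).mem_toFinset.1 hp
      obtain ⟨h1, h2, h3, -⟩ := id hp'
      have h4 : μ.src = p.1.rng := hs.trans h1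
      have h5 : τ.src = p.2.rng := hs'.symm.trans h2
      rw [ht.mul_eq _ _ h4, ht.mul_eq _ _ h5]
      refine ⟨_, hS μ hμ ν hν σ hσ hd hs p hp' h4, _,
        hS τ hτ σ hσ ν hν hd'.symm hs'.symm _ (Lmin_symm hp') h5, ?_, ?_, rfl⟩
      · have h6 := congrArg Path.deg h3
        rw [Path.deg_comp, Path.deg_comp] at h6 ⊢
        change μ.deg + p.1.deg = τ.deg + p.2.deg
        rw [hd, h6, hd']
      · exact (congrArg Path.src h3 : (ν.comp p.1 h1).src = (σ.comp p.2 h2).src)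
    | zero_left y hy => rw [zero_mul]; exact Submodule.zero_mem _
    | zero_right x hx => rw [mul_zero]; exact Submodule.zero_mem _
    | add_left x y z hx hy hz h1 h2 => rw [add_mul]; exact Submodule.add_mem _ h1 h2
    | add_right x y z hx hy hz h1 h2 => rw [mul_add]; exact Submodule.add_mem _ h1 h2
    | smul_left r x y hx hy h => rw [smul_mul_assoc]; exact Submodule.smul_mem _ _ h
    | smul_right r x y hx hy h => rw [mul_smul_comm]; exact Submodule.smul_mem _ _ h
  star_mem' {a} ha := by
    change a ∈ Submodule.span ℂ _ at ha
    change star a ∈ Submodule.span ℂ _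
    induction ha using Submodule.span_induction with
    | mem x hx =>
      obtain ⟨μ, hμ, ν, hν, hd, hs, rfl⟩ := hx
      exact Submodule.subset_span ⟨ν, hν, μ, hμ, hd.symm, hs.symm, by rw [star_mul, star_star]⟩
    | zero => rw [star_zero]; exact Submodule.zero_mem _
    | add x y hx hy h1 h2 => rw [star_add]; exact Submodule.add_mem _ h1 h2
    | smul r x hx h => rw [star_smul]; exact Submodule.smul_mem _ _ h

theorem mem_coreAlgebra (hΛ : Λ.FinitelyAligned) (ht : Λ.IsCuntzKrieger t)
    {S : Finset Λ.Path} (hS : IsSaturated (S : Set Λ.Path)) {a : A} :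
    a ∈ coreAlgebra hΛ ht hS ↔ a ∈ Submodule.span ℂ (coreGenerators t S) := Iff.rfl

theorem isClosed_coreAlgebra (hΛ : Λ.FinitelyAligned) (ht : Λ.IsCuntzKrieger t)
    {S : Finset Λ.Path} (hS : IsSaturated (S : Set Λ.Path)) :
    IsClosed (coreAlgebra hΛ ht hS : Set A) := by
  have : FiniteDimensional ℂ (Submodule.span ℂ (coreGenerators t S)) :=
    FiniteDimensional.span_of_finite ℂ (finite_coreGenerators t S)
  exact Submodule.closed_of_finiteDimensional (Submodule.span ℂ (coreGenerators t S))

theorem mem_span_matUnit (hΛ : Λ.FinitelyAligned) (ht : Λ.IsCuntzKrieger t)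
    {S : Finset Λ.Path} (hS : IsSaturated (S : Set Λ.Path)) {a : A}
    (ha : a ∈ coreAlgebra hΛ ht hS) : a ∈ Submodule.span ℂ {a | ∃ σ ∈ S, ∃ σ' ∈ S,
      σ.deg = σ'.deg ∧ σ.src = σ'.src ∧ matUnit t S σ σ' = a} := by
  rw [mem_coreAlgebra] at ha
  refine Submodule.span_le.2 ?_ ha
  rintro _ ⟨μ, hμ, ν, hν, hd, hs, rfl⟩
  exact mul_star_mem_span_matUnit hΛ ht hS hμ hν hd hs

/-- The product relation for exhaustive sets removes exactly the blocks for which no avoiding path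
exists. -/
theorem tailGap_eq_zero (ht : Λ.IsCuntzKrieger t) {S : Finset Λ.Path} {μ : Λ.Path}
    (h : Λ.Exhaustive μ.src {ν | ν ∈ tails S μ}) : tailGap t S μ = 0 :=
  ht.prod_eq_zero _ _ (Finset.nodup_toList _) h

section Hom

variable {B : Type w} [NonUnitalCStarAlgebra B] (π : A →⋆ₙₐ[ℂ] B)

theorem map_gap (v : Λ.Obj) (l : List Λ.Path) :
    π (gap t v l) = gap (fun μ => π (t μ)) v l := by
  induction l with
  | nil => rfl
  | cons μ l ih => rw [gap_cons, gap_cons, map_mul, ih, map_sub, map_mul, map_star]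

theorem map_matUnit (S : Finset Λ.Path) (μ ν : Λ.Path) :
    π (matUnit t S μ ν) = matUnit (fun μ => π (t μ)) S μ ν := by
  rw [matUnit, matUnit, map_mul, map_mul, map_star, tailGap, tailGap, map_gap]

theorem Avoids.commute_corner (hΛ : Λ.FinitelyAligned) (ht : Λ.IsCuntzKrieger t)
    {S : Finset Λ.Path} (hS : IsSaturated (S : Set Λ.Path)) {μ ρ : Λ.Path} (h : Avoids S μ ρ)
    (hμ : μ ∈ S) {a : A} (ha : a ∈ coreAlgebra hΛ ht hS) :
    Commute (corner (fun μ => π (t μ)) S μ ρ) (π a) := by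
  replace ha := mem_span_matUnit hΛ ht hS ha
  induction ha using Submodule.span_induction with
  | mem x hx =>
    obtain ⟨σ, hσ, σ', hσ', hd, hs, rfl⟩ := hx
    rw [map_matUnit]
    exact h.commute_corner_matUnit hΛ (ht.map hΛ π) hS hμ hσ hσ' hd hs
  | zero => rw [map_zero]; exact Commute.zero_right _
  | add x y hx hy h1 h2 => rw [map_add]; exact h1.add_right h2
  | smul r x hx h1 => rw [map_smul]; exact h1.smul_right r

/-- An element of the core algebra vanishes if all its compressions to corners in the image of `π`
vanish. -/
theorem eq_zero_of_corner_mul_eq_zero (hΛ : Λ.FinitelyAligned) (ht : Λ.IsCuntzKrieger t)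
    (hπ : ∀ v, π (t (Λ.vertex v)) ≠ 0)
    {S : Finset Λ.Path} (hS : IsSaturated (S : Set Λ.Path)) {a : A}
    (ha : a ∈ coreAlgebra hΛ ht hS)
    (h : ∀ μ ∈ S, ¬ Λ.Exhaustive μ.src {ν | ν ∈ tails S μ} →
      ∃ ρ, Avoids S μ ρ ∧ corner (fun μ => π (t μ)) S μ ρ * π a = 0) : a = 0 := by
  classical
  have ha' := mem_span_matUnit hΛ ht hS ha
  have e : {a | ∃ σ ∈ S, ∃ σ' ∈ S, σ.deg = σ'.deg ∧ σ.src = σ'.src ∧ matUnit t S σ σ' = a} =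
      (fun p : Λ.Path × Λ.Path => matUnit t S p.1 p.2) ''
        ((S ×ˢ S).filter fun p => p.1.deg = p.2.deg ∧ p.1.src = p.2.src : Finset _) := by
    ext x
    simp only [Set.mem_ofPred_eq, Set.mem_image, Finset.coe_filter, Finset.mem_product, Prod.exists]
    constructor
    · rintro ⟨σ, hσ, σ', hσ', hd, hs, rfl⟩
      exact ⟨σ, σ', ⟨⟨hσ, hσ'⟩, hd, hs⟩, rfl⟩
    · rintro ⟨σ, σ', ⟨⟨hσ, hσ'⟩, hd, hs⟩, rfl⟩
      exact ⟨σ, hσ, σ', hσ', hd, hs, rfl⟩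
  rw [e, Submodule.mem_span_image_finset_iff_exists_fun'] at ha'
  obtain ⟨c, rfl⟩ := ha'
  have hu := ht.map hΛ π
  refine Finset.sum_eq_zero fun p hp => ?_
  obtain ⟨σ, σ'⟩ := p
  obtain ⟨hσσ', hd, hs⟩ := Finset.mem_filter.1 hp
  obtain ⟨hσ, hσ'⟩ := Finset.mem_product.1 hσσ'
  dsimp only at hσ hσ' hd hs ⊢
  by_cases hex : Λ.Exhaustive σ.src {ν | ν ∈ tails S σ}
  · rw [matUnit, tailGap_eq_zero ht hex, mul_zero, zero_mul, smul_zero]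
  obtain ⟨ρ, hρ, h0⟩ := h σ hσ hex
  have hσb : σ ∈ block S σ := mem_block.2 ⟨hσ, rfl, rfl⟩
  have hσ'b : σ' ∈ block S σ := mem_block.2 ⟨hσ', hd.symm, hs.symm⟩
  set s : Λ.Path → B := fun μ => π (t μ) with hs_def
  -- This extracts one coefficient: compressing $\pi(a)$ between $s_{\sigma\rho}$ and
  -- $s_{\sigma'\rho}$ leaves $c_{\sigma,\sigma'}\,\pi(t_{s(\rho)})$, and the vertex projection is
  -- nonzero under $\pi$.
  have h1 : star (s σ * s ρ) * π (∑ p ∈ (S ×ˢ S).filter fun p => p.1.deg = p.2.deg ∧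
      p.1.src = p.2.src, c p • matUnit t S p.1 p.2) * (s σ' * s ρ) = 0 := by
    rw [← hρ.star_mul_corner hu hS hσ hσb, mul_assoc (star _), h0, mul_zero, zero_mul]
  rw [map_sum, Finset.mul_sum, Finset.sum_mul, Finset.sum_eq_single_of_mem (σ, σ') hp] at h1
  · dsimp only at h1
    rw [map_smul, map_matUnit, mul_smul_comm, smul_mul_assoc, hρ.star_mul_matUnit hΛ hu,
      (hρ.block hS hσ hσ'b).star_mul_self hu] at h1
    rw [(smul_eq_zero.1 h1).resolve_right (hπ _), zero_smul]
  · rintro ⟨κ, κ'⟩ hκ hne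
    obtain ⟨hκκ', kd, ks⟩ := Finset.mem_filter.1 hκ
    obtain ⟨hκ, hκ'⟩ := Finset.mem_product.1 hκκ'
    dsimp only at hκ hκ' kd ks ⊢
    rw [map_smul, map_matUnit, mul_smul_comm, smul_mul_assoc]
    by_cases h2 : κ = σ
    · subst h2
      have hκ'b : κ' ∈ block S κ := mem_block.2 ⟨hκ', kd.symm, ks.symm⟩
      rw [hρ.star_mul_matUnit hΛ hu, hρ.star_mul_of_ne hu hS hσ hκ'b hσ'b, smul_zero]
      rintro rfl
      exact hne rfl
    · rw [hρ.star_mul_matUnit_of_ne hΛ hu hS hσ hκ h2, zero_mul, smul_zero]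

/-- The diagonal part of a finite sum of elements `t_μ t_ν^*` is bounded by the image of the sum
under any homomorphism that does not vanish at the vertex projections. -/
theorem norm_diagonal_le (hΛ : Λ.FinitelyAligned) (hB : Λ.ConditionB) (ht : Λ.IsCuntzKrieger t)
    (hπ : ∀ v, π (t (Λ.vertex v)) ≠ 0) (J : Finset (Λ.Path × Λ.Path))
    (hJ : ∀ p ∈ J, p.1.src = p.2.src) (c : Λ.Path × Λ.Path → ℂ) [DecidableEq (Fin k → ℕ)] :
    ‖∑ p ∈ J with p.1.deg = p.2.deg, c p • (t p.1 * star (t p.2))‖ ≤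
      ‖π (∑ p ∈ J, c p • (t p.1 * star (t p.2)))‖ := by
  classical
  obtain ⟨S', hfin, hES, hS⟩ := exists_finite_saturated hΛ
    (E := (J.image Prod.fst ∪ J.image Prod.snd : Finset Λ.Path)) (Finset.finite_toSet _)
  obtain ⟨S, rfl⟩ := hfin.exists_finset_coe
  have hJS : ∀ p ∈ J, p.1 ∈ S ∧ p.2 ∈ S := fun p hp =>
    ⟨hES (Finset.mem_coe.2 (Finset.mem_union_left _ (Finset.mem_image_of_mem _ hp))),
      hES (Finset.mem_coe.2 (Finset.mem_union_right _ (Finset.mem_image_of_mem _ hp)))⟩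
  have hu := ht.map hΛ π
  set s : Λ.Path → B := fun μ => π (t μ) with hs_def
  choose! ρ hρ hsep using fun (μ : Λ.Path)
    (h : ¬ Λ.Exhaustive μ.src {ν | ν ∈ tails S μ}) => hB.exists_avoids S h
  let ι := {μ : S // ¬ Λ.Exhaustive μ.1.src {ν | ν ∈ tails S μ.1}}
  have hι : ∀ i : ι, Avoids S i.1.1 (ρ i.1.1) := fun i => hρ _ i.2
  let Q : ι → B := fun i => corner s S i.1.1 (ρ i.1.1)
  have hQQ : ∀ i, Q i * Q i = Q i := fun i => (hι i).corner_mul_corner hu hS i.1.2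
  have hQs : ∀ i, star (Q i) = Q i := fun i => star_corner _ _ _
  have hQn : ∀ i, ‖Q i‖ ≤ 1 := fun i => IsStarProjection.norm_le _ ⟨hQQ i, hQs i⟩
  have hQc : ∀ i, ∀ a ∈ coreAlgebra hΛ ht hS, Q i * π a = π a * Q i := fun i a ha =>
    ((hι i).commute_corner π hΛ ht hS i.1.2 ha).eq
  let _ : NonUnitalCStarAlgebra (coreAlgebra hΛ ht hS) :=
    NonUnitalStarSubalgebra.nonUnitalCStarAlgebra _ (h_closed := isClosed_coreAlgebra hΛ ht hS)
  -- Cutting by `Q i` is multiplicative on the core because `Q i` is a projection commuting with its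
  -- image.
  let Ψ : coreAlgebra hΛ ht hS →⋆ₙₐ[ℂ] (ι → B) :=
    { toFun := fun a i => Q i * π a
      map_smul' := fun r a => by
        funext i
        change Q i * π (r • (a : A)) = r • (Q i * π a)
        rw [map_smul, mul_smul_comm]
      map_zero' := by
        funext i
        change Q i * π 0 = 0
        rw [map_zero, mul_zero]
      map_add' := fun a b => by
        funext i
        change Q i * π (a + b) = Q i * π a + Q i * π b
        rw [map_add, mul_add]
      map_mul' := fun a b => by
        funext i
        change Q i * π (a * b) = Q i * π a * (Q i * π b)
        rw [mul_assoc, ← mul_assoc (π a), ← hQc i a a.2, ← mul_assoc, ← mul_assoc, hQQ, map_mul,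
          mul_assoc]
      map_star' := fun a => by
        funext i
        change Q i * π (star (a : A)) = star (Q i * π a)
        rw [star_mul, hQs, map_star, ← map_star, hQc i _ (star_mem a.2)] }
  have hΨ : Function.Injective Ψ := by
    rw [injective_iff_map_eq_zero]
    intro a ha
    refine Subtype.ext (eq_zero_of_corner_mul_eq_zero π hΛ ht hπ hS a.2 fun μ hμ hex => ?_)
    exact ⟨ρ μ, hρ μ hex, congrFun ha ⟨⟨μ, hμ⟩, hex⟩⟩
  have hmem : ∑ p ∈ J with p.1.deg = p.2.deg, c p • (t p.1 * star (t p.2)) ∈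
      coreAlgebra hΛ ht hS := by
    rw [mem_coreAlgebra]
    refine Submodule.sum_mem _ fun p hp => Submodule.smul_mem _ _ (Submodule.subset_span ?_)
    obtain ⟨h1, h2⟩ := Finset.mem_filter.1 hp
    exact ⟨p.1, (hJS p h1).1, p.2, (hJS p h1).2, h2, hJ p h1, rfl⟩
  -- An injective $*$-homomorphism of $C^*$-algebras is isometric; the core is one, since a
  -- finite-dimensional subspace is closed.
  have hnorm := NonUnitalStarAlgHom.norm_map Ψ hΨ ⟨_, hmem⟩
  change _ = ‖∑ p ∈ J with p.1.deg = p.2.deg, c p • (t p.1 * star (t p.2))‖ at hnorm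
  rw [← hnorm, pi_norm_le_iff_of_nonneg (norm_nonneg _)]
  intro i
  change ‖Q i * π (∑ p ∈ J with p.1.deg = p.2.deg, c p • (t p.1 * star (t p.2)))‖ ≤ _
  -- The corner annihilates the terms of unequal degree, so the diagonal part may be replaced by the
  -- whole sum.
  have hcut : Q i * π (∑ p ∈ J with p.1.deg = p.2.deg, c p • (t p.1 * star (t p.2))) =
      Q i * π (∑ p ∈ J, c p • (t p.1 * star (t p.2))) * Q i := by
    have h1 : Q i * π (∑ p ∈ J with ¬ p.1.deg = p.2.deg, c p • (t p.1 * star (t p.2))) * Q i =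
        0 := by
      rw [map_sum, Finset.mul_sum, Finset.sum_mul]
      refine Finset.sum_eq_zero fun p hp => ?_
      obtain ⟨h1, h2⟩ := Finset.mem_filter.1 hp
      rw [map_smul, mul_smul_comm, smul_mul_assoc, map_mul, map_star]
      have h3 := (hι i).corner_mul_mul_corner hu hS i.1.2 (hsep _ i.2) (hJS p h1).1 (hJS p h1).2 h2
      change c p • (Q i * (s p.1 * star (s p.2)) * Q i) = 0
      rw [h3, smul_zero]
    rw [← Finset.sum_filter_add_sum_filter_not J fun p => p.1.deg = p.2.deg, map_add, mul_add,
      add_mul, h1, add_zero, mul_assoc, ← hQc i _ hmem, ← mul_assoc, hQQ]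
  rw [hcut]
  refine (norm_mul_le _ _).trans ((mul_le_of_le_one_right (norm_nonneg _) (hQn i)).trans ?_)
  exact (norm_mul_le _ _).trans (mul_le_of_le_one_left (norm_nonneg _) (hQn i))

end Hom

end CoreAlgebra

/-! ### The gauge action and averaging over roots of unity -/

section Gauge

variable {k : ℕ} {Λ : KGraph.{u} k}

/-- The number `z^{d(μ)}`, for `z` in the torus. -/
noncomputable def phase (z : Fin k → Circle) (μ : Λ.Path) : Circle := ∏ i, z i ^ μ.deg i

theorem phase_vertex (z : Fin k → Circle) (v : Λ.Obj) : phase z (Λ.vertex v) = 1 := by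
  simp [phase]

theorem phase_comp (z : Fin k → Circle) (μ ν : Λ.Path) (h : μ.src = ν.rng) :
    phase z (μ.comp ν h) = phase z μ * phase z ν := by
  simp [phase, pow_add, Finset.prod_mul_distrib]

theorem phase_mul_star (z : Fin k → Circle) (μ : Λ.Path) :
    (phase z μ : ℂ) * star (phase z μ : ℂ) = 1 := by
  rw [Complex.star_def, Complex.mul_conj, Circle.normSq_coe, Complex.ofReal_one]

theorem star_phase_mul (z : Fin k → Circle) (μ : Λ.Path) :
    star (phase z μ : ℂ) * (phase z μ : ℂ) = 1 := by
  rw [mul_comm, phase_mul_star]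

variable {A : Type v} [NonUnitalCStarAlgebra A] {t : Λ.Path → A}

theorem smul_mul_star_smul (c d : ℂ) (a b : A) :
    (c • a) * star (d • b) = (c * star d) • (a * star b) := by
  rw [star_smul, smul_mul_smul_comm]

/-- The relations are homogeneous. For $\mu\alpha=\nu\beta$ one has
$\overline{z^{d(\mu)}}z^{d(\nu)}=z^{d(\alpha)}\overline{z^{d(\beta)}}$, and phases cancel in range
projections. -/
theorem IsCuntzKrieger.phase_smul (ht : Λ.IsCuntzKrieger t) (z : Fin k → Circle) :
    Λ.IsCuntzKrieger fun μ => (phase z μ : ℂ) • t μ where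
  partial_isometry μ := by
    rw [smul_mul_star_smul, phase_mul_star, one_smul, mul_smul_comm, ht.partial_isometry]
  vertex_projection v := by
    rw [phase_vertex, Circle.coe_one, one_smul]
    exact ht.vertex_projection v
  vertex_orthogonal v w h := by
    rw [smul_mul_smul_comm, ht.vertex_orthogonal v w h, smul_zero]
  mul_eq μ ν h := by
    rw [smul_mul_smul_comm, ht.mul_eq μ ν h, phase_comp, Circle.coe_mul]
  star_mul_eq μ ν := by
    rw [star_smul, smul_mul_smul_comm, ht.star_mul_eq, smul_finsum]
    refine finsum_congr fun p => ?_
    rw [smul_finsum]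
    refine finsum_congr fun hp => ?_
    obtain ⟨h1, h2, h3, -⟩ := hp
    rw [smul_mul_star_smul]
    congr 1
    have h4 := congrArg (fun κ => (phase z κ : ℂ)) h3
    simp only [phase_comp, Circle.coe_mul] at h4
    calc _ = star (phase z μ : ℂ) * (phase z ν * (phase z p.2 * star (phase z p.2 : ℂ))) := by
          rw [phase_mul_star, mul_one]
      _ = star (phase z μ : ℂ) * (phase z μ * phase z p.1) * star (phase z p.2 : ℂ) := by
          rw [h4]
          ring
      _ = _ := by rw [← mul_assoc, star_phase_mul, one_mul]
  prod_eq_zero v E hE hE' := by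
    rw [← ht.prod_eq_zero v E hE hE']
    simp only [phase_vertex, Circle.coe_one, one_smul, smul_mul_star_smul, phase_mul_star]

/-- The Cuntz-Krieger family obtained from `i` by the gauge action. -/
noncomputable def CKFamily.twist (z : Fin k → Circle) (i : CKFamily.{u, w} Λ) :
    CKFamily.{u, w} Λ :=
  ⟨i.Alg, fun μ => (phase z μ : ℂ) • i.elt μ, i.isCK.phase_smul z⟩

/-- The gauge action on the bounded elements of the product of all Cuntz-Krieger families. -/
noncomputable def gauge (z : Fin k → Circle) :
    lp (fun i : CKFamily.{u, w} Λ => i.Alg) ∞ →⋆ₙₐ[ℂ]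
      lp (fun i : CKFamily.{u, w} Λ => i.Alg) ∞ where
  toFun a := ⟨fun i => a (i.twist z), memℓp_infty ⟨‖a‖, by
    rintro _ ⟨i, rfl⟩
    exact lp.norm_apply_le_norm ENNReal.top_ne_zero a (i.twist z)⟩⟩
  map_smul' _ _ := rfl
  map_zero' := rfl
  map_add' _ _ := rfl
  map_mul' _ _ := rfl
  map_star' _ := rfl

/-- The action only permutes coordinates: coordinate `i` is read off at the twisted family, whose
members are the phase multiples of those of `i`. -/
theorem gauge_sumFamily (z : Fin k → Circle) (μ : Λ.Path) :
    gauge z (sumFamily.{u, w} Λ μ) = (phase z μ : ℂ) • sumFamily.{u, w} Λ μ := rfl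

theorem norm_gauge_le (z : Fin k → Circle) (a : lp (fun i : CKFamily.{u, w} Λ => i.Alg) ∞) :
    ‖gauge z a‖ ≤ ‖a‖ := NonUnitalStarAlgHom.norm_apply_le _ a

theorem gauge_mul_star (z : Fin k → Circle) (μ ν : Λ.Path) :
    gauge z (sumFamily.{u, w} Λ μ * star (sumFamily.{u, w} Λ ν)) =
      ((phase z μ : ℂ) * star (phase z ν : ℂ)) •
        (sumFamily.{u, w} Λ μ * star (sumFamily.{u, w} Λ ν)) := by
  rw [map_mul, map_star, gauge_sumFamily, gauge_sumFamily, smul_mul_star_smul]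

theorem gauge_star_mul_nonneg [PartialOrder (lp (fun i : CKFamily.{u, w} Λ => i.Alg) ∞)]
    [StarOrderedRing (lp (fun i : CKFamily.{u, w} Λ => i.Alg) ∞)] (z : Fin k → Circle)
    (a : lp (fun i : CKFamily.{u, w} Λ => i.Alg) ∞) : 0 ≤ gauge z (star a * a) := by
  rw [map_mul, map_star]
  exact star_mul_self_nonneg _

/-- The `*`-algebra generated by a Cuntz-Krieger family is spanned by the elements `t_μ t_ν^*`. -/
theorem adjoin_le_span (hΛ : Λ.FinitelyAligned) (ht : Λ.IsCuntzKrieger t) {a : A}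
    (ha : a ∈ NonUnitalStarAlgebra.adjoin ℂ (Set.range t)) :
    a ∈ Submodule.span ℂ ((fun p : Λ.Path × Λ.Path => t p.1 * star (t p.2)) ''
      {p | p.1.src = p.2.src}) := by
  induction ha using NonUnitalStarAlgebra.adjoin_induction with
  | mem x hx =>
    obtain ⟨μ, rfl⟩ := hx
    refine Submodule.subset_span ⟨(μ, Λ.vertex μ.src), rfl, ?_⟩
    change t μ * star (t (Λ.vertex μ.src)) = t μ
    rw [ht.star_vertex, ht.mul_vertex μ rfl]
  | add x y hx hy h1 h2 => exact add_mem h1 h2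
  | zero => exact zero_mem _
  | mul x y hx hy h1 h2 =>
    clear hx hy
    induction h1, h2 using Submodule.span_induction₂ with
    | mem_mem x y hx hy =>
      obtain ⟨⟨μ, ν⟩, hs, rfl⟩ := hx
      obtain ⟨⟨σ, τ⟩, hs', rfl⟩ := hy
      change μ.src = ν.src at hs
      change σ.src = τ.src at hs'
      change t μ * star (t ν) * (t σ * star (t τ)) ∈ _
      rw [mul_star_mul_mul_star hΛ ht]
      refine Submodule.sum_mem _ fun p hp => Submodule.subset_span ?_
      obtain ⟨h1, h2, h3, -⟩ := (hΛ ν σ).mem_toFinset.1 hp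
      rw [ht.mul_eq _ _ (hs.trans h1), ht.mul_eq _ _ (hs'.symm.trans h2)]
      exact ⟨(μ.comp p.1 (hs.trans h1), τ.comp p.2 (hs'.symm.trans h2)),
        (congrArg Path.src h3 : (ν.comp p.1 h1).src = (σ.comp p.2 h2).src), rfl⟩
    | zero_left y hy => rw [zero_mul]; exact Submodule.zero_mem _
    | zero_right x hx => rw [mul_zero]; exact Submodule.zero_mem _
    | add_left x y z hx hy hz h1 h2 => rw [add_mul]; exact Submodule.add_mem _ h1 h2
    | add_right x y z hx hy hz h1 h2 => rw [mul_add]; exact Submodule.add_mem _ h1 h2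
    | smul_left r x y hx hy h => rw [smul_mul_assoc]; exact Submodule.smul_mem _ _ h
    | smul_right r x y hx hy h => rw [mul_smul_comm]; exact Submodule.smul_mem _ _ h
  | smul r x hx h1 => exact Submodule.smul_mem _ _ h1
  | star x hx h1 =>
    clear hx
    induction h1 using Submodule.span_induction with
    | mem x hx =>
      obtain ⟨⟨μ, ν⟩, hs, rfl⟩ := hx
      refine Submodule.subset_span ⟨(ν, μ), Eq.symm hs, ?_⟩
      change t ν * star (t μ) = star (t μ * star (t ν))
      rw [star_mul, star_star]
    | zero => rw [star_zero]; exact Submodule.zero_mem _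
    | add x y hx hy h1 h2 => rw [star_add]; exact Submodule.add_mem _ h1 h2
    | smul r x hx h => rw [star_smul]; exact Submodule.smul_mem _ _ h

/-- Elements of `C*(Λ)` are approximated by finite sums of elements `s_μ s_ν^*`. -/
theorem exists_norm_sub_sum_lt (hΛ : Λ.FinitelyAligned) (a : CStar.{u, w} Λ) {ε : ℝ} (hε : 0 < ε) :
    ∃ (J : Finset (Λ.Path × Λ.Path)) (c : Λ.Path × Λ.Path → ℂ), (∀ p ∈ J, p.1.src = p.2.src) ∧
      ‖a - ∑ p ∈ J, c p • (gen Λ p.1 * star (gen Λ p.2))‖ < ε := by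
  have ha : (a : lp (fun i : CKFamily.{u, w} Λ => i.Alg) ∞) ∈ closure
      (NonUnitalStarAlgebra.adjoin ℂ (Set.range (sumFamily.{u, w} Λ)) : Set _) := a.2
  obtain ⟨y, hy, hay⟩ := Metric.mem_closure_iff.1 ha ε hε
  obtain ⟨l, hl, rfl⟩ := (Finsupp.mem_span_image_iff_linearCombination ℂ).1
    (adjoin_le_span hΛ (isCuntzKrieger_sumFamily hΛ) hy)
  refine ⟨l.support, l, fun p hp => hl hp, ?_⟩
  rw [dist_eq_norm, Finsupp.linearCombination_apply, Finsupp.sum] at hay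
  refine lt_of_eq_of_lt ?_ hay
  change ‖((a - ∑ p ∈ l.support, l p • (gen Λ p.1 * star (gen Λ p.2)) : CStar.{u, w} Λ) :
    lp (fun i : CKFamily.{u, w} Λ => i.Alg) ∞)‖ = _
  congr 1
  change (a : lp (fun i : CKFamily.{u, w} Λ => i.Alg) ∞) - (_ : CStar.{u, w} Λ) = _
  congr 1
  simp only [AddSubmonoidClass.coe_finsetSum]
  rfl

theorem gauge_sum (z : Fin k → Circle) (J : Finset (Λ.Path × Λ.Path))
    (c : Λ.Path × Λ.Path → ℂ) :
    gauge z ((∑ p ∈ J, c p • (gen Λ p.1 * star (gen Λ p.2)) : CStar.{u, w} Λ) :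
      lp (fun i : CKFamily.{u, w} Λ => i.Alg) ∞) =
      ∑ p ∈ J, (((phase z p.1 : ℂ) * star (phase z p.2 : ℂ)) * c p) •
        ((gen Λ p.1 * star (gen Λ p.2) : CStar.{u, w} Λ) :
          lp (fun i : CKFamily.{u, w} Λ => i.Alg) ∞) := by
  rw [AddSubmonoidClass.coe_finsetSum, map_sum]
  refine Finset.sum_congr rfl fun p _ => ?_
  change gauge z (c p • (sumFamily.{u, w} Λ p.1 * star (sumFamily.{u, w} Λ p.2))) = _
  rw [map_smul, gauge_mul_star, smul_smul, mul_comm]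
  rfl

theorem continuous_phase (μ : Λ.Path) : Continuous fun z : Fin k → Circle => (phase z μ : ℂ) := by
  unfold phase
  fun_prop

/-- The gauge action is strongly continuous at the identity. -/
theorem exists_norm_gauge_sub_le (hΛ : Λ.FinitelyAligned) (a : CStar.{u, w} Λ) {ε : ℝ}
    (hε : 0 < ε) : ∃ δ > 0, ∀ θ : Fin k → ℝ, (∀ i, |θ i| < δ) →
      ‖gauge (fun i => Circle.exp (θ i)) (a : lp (fun i : CKFamily.{u, w} Λ => i.Alg) ∞) - a‖ ≤
        ε := by
  obtain ⟨J, c, -, hJ⟩ := exists_norm_sub_sum_lt hΛ a (show 0 < ε / 3 by positivity)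
  set y : CStar.{u, w} Λ := ∑ p ∈ J, c p • (gen Λ p.1 * star (gen Λ p.2)) with hy
  have hcont : Continuous fun θ : Fin k → ℝ => gauge (fun i => Circle.exp (θ i))
      (y : lp (fun i : CKFamily.{u, w} Λ => i.Alg) ∞) := by
    simp only [hy, gauge_sum]
    refine continuous_finsetSum _ fun p _ => ?_
    have hphase : ∀ μ : Λ.Path, Continuous fun θ : Fin k → ℝ =>
        (phase (fun i => Circle.exp (θ i)) μ : ℂ) := fun μ =>
      (continuous_phase μ).comp (by fun_prop)
    have hphase' : Continuous fun θ : Fin k → ℝ => (phase (fun i => Circle.exp (θ i)) p.1 : ℂ) *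
        star (phase (fun i => Circle.exp (θ i)) p.2 : ℂ) * c p :=
      ((hphase p.1).mul (hphase p.2).star).mul continuous_const
    exact hphase'.smul continuous_const
  have h0 : gauge (fun i => Circle.exp ((0 : Fin k → ℝ) i))
      (y : lp (fun i : CKFamily.{u, w} Λ => i.Alg) ∞) = y := by
    simp only [Pi.zero_apply, Circle.exp_zero]
    rw [hy, gauge_sum, AddSubmonoidClass.coe_finsetSum]
    refine Finset.sum_congr rfl fun p _ => ?_
    simp [phase]
  obtain ⟨δ, hδ, h⟩ := Metric.continuous_iff.1 hcont 0 (ε / 3) (by positivity)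
  refine ⟨δ, hδ, fun θ hθ => ?_⟩
  have h1 := h θ (by
    rw [dist_zero_right, pi_norm_lt_iff hδ]
    exact hθ)
  rw [h0, dist_eq_norm] at h1
  set g := gauge (Λ := Λ) (fun i => Circle.exp (θ i))
  have h2 : ‖g (a - y : CStar.{u, w} Λ)‖ < ε / 3 := (norm_gauge_le _ _).trans_lt hJ
  have e : g a - (a : lp (fun i : CKFamily.{u, w} Λ => i.Alg) ∞) =
      g (a - y : CStar.{u, w} Λ) + (g y - y) - (a - y : CStar.{u, w} Λ) := by
    rw [AddSubgroupClass.coe_sub, map_sub]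
    abel
  rw [e]
  have h3 := norm_sub_le (g (a - y : CStar.{u, w} Λ) + (g y - y)) (a - y : CStar.{u, w} Λ)
  have h4 := norm_add_le (g (a - y : CStar.{u, w} Λ)) (g y - y)
  have h5 : ‖((a - y : CStar.{u, w} Λ) : lp (fun i : CKFamily.{u, w} Λ => i.Alg) ∞)‖ < ε / 3 := hJ
  linarith

theorem sum_pow_mul_star_pow {N : ℕ} (hN : N ≠ 0) {a b : ℕ} (ha : a < N) (hb : b < N) :
    ∑ j ∈ Finset.range N, ((Circle.exp (j * (2 * Real.pi / N)) ^ a : Circle) : ℂ) *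
      star ((Circle.exp (j * (2 * Real.pi / N)) ^ b : Circle) : ℂ) = if a = b then (N : ℂ) else 0 := by
  have hζ := Complex.isPrimitiveRoot_exp N hN
  set ζ := Complex.exp (2 * Real.pi * Complex.I / N) with hζd
  have hζ0 : ζ ≠ 0 := Complex.exp_ne_zero _
  have hexp : ∀ j : ℕ, ((Circle.exp (j * (2 * Real.pi / N)) : Circle) : ℂ) = ζ ^ j := by
    intro j
    rw [Circle.coe_exp, hζd, ← Complex.exp_nat_mul]
    congr 1
    push_cast
    ring
  have hterm : ∀ j : ℕ, ((Circle.exp (j * (2 * Real.pi / N)) ^ a : Circle) : ℂ) *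
      star ((Circle.exp (j * (2 * Real.pi / N)) ^ b : Circle) : ℂ) = (ζ ^ a * (ζ ^ b)⁻¹) ^ j := by
    intro j
    rw [Complex.star_def, ← Circle.coe_inv_eq_conj, Circle.coe_inv, Circle.coe_pow, Circle.coe_pow,
      hexp, mul_pow, inv_pow, ← pow_mul, ← pow_mul, ← pow_mul, ← pow_mul, mul_comm j, mul_comm j]
  simp only [hterm]
  split_ifs with h
  · subst h
    rw [mul_inv_cancel₀ (pow_ne_zero _ hζ0)]
    simp
  · have h1 : ζ ^ a * (ζ ^ b)⁻¹ ≠ 1 := fun h2 => h (hζ.pow_inj ha hb (by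
      rw [← div_eq_mul_inv, div_eq_one_iff_eq (pow_ne_zero _ hζ0)] at h2
      exact h2))
    rw [geom_sum_eq h1, mul_pow, inv_pow, ← pow_mul, ← pow_mul, mul_comm a, mul_comm b, pow_mul,
      pow_mul, hζ.pow_eq_one]
    simp

/-- Averaging over the `N`-th roots of unity projects to the elements of degree zero. -/
theorem sum_phase_mul_star_phase {N : ℕ} (hN : N ≠ 0) {μ ν : Λ.Path} (hμ : ∀ i, μ.deg i < N)
    (hν : ∀ i, ν.deg i < N) [DecidableEq (Fin k → ℕ)] :
    ∑ j ∈ Fintype.piFinset fun _ : Fin k => Finset.range N,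
      (phase (fun i => Circle.exp (j i * (2 * Real.pi / N))) μ : ℂ) *
        star (phase (fun i => Circle.exp (j i * (2 * Real.pi / N))) ν : ℂ) =
      if μ.deg = ν.deg then (N : ℂ) ^ k else 0 := by
  have h1 : ∀ j : Fin k → ℕ, (phase (fun i => Circle.exp (j i * (2 * Real.pi / N))) μ : ℂ) *
        star (phase (fun i => Circle.exp (j i * (2 * Real.pi / N))) ν : ℂ) =
      ∏ i, ((Circle.exp (j i * (2 * Real.pi / N)) ^ μ.deg i : Circle) : ℂ) *
        star ((Circle.exp (j i * (2 * Real.pi / N)) ^ ν.deg i : Circle) : ℂ) := by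
    intro j
    have hc : ∀ f : Fin k → Circle, ((∏ i, f i : Circle) : ℂ) = ∏ i, (f i : ℂ) := fun f =>
      map_prod Circle.coeHom f Finset.univ
    rw [phase, phase, hc, hc, star_prod, Finset.prod_mul_distrib]
  simp only [h1]
  rw [← Finset.prod_univ_sum (fun _ : Fin k => Finset.range N) fun i j =>
    ((Circle.exp (j * (2 * Real.pi / N)) ^ μ.deg i : Circle) : ℂ) *
      star ((Circle.exp (j * (2 * Real.pi / N)) ^ ν.deg i : Circle) : ℂ)]
  simp only [sum_pow_mul_star_pow hN (hμ _) (hν _)]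
  split_ifs with h
  · simp [h]
  · obtain ⟨i, hi⟩ := Function.ne_iff.1 h
    exact Finset.prod_eq_zero (Finset.mem_univ i) (if_neg hi)

end Gauge

/-! ### From the diagonal estimate to injectivity -/

section Injectivity

variable {k : ℕ} {Λ : KGraph.{u} k} {B : Type v} [NonUnitalCStarAlgebra B]

/-- The sum of the gauge translates over the `N`-th roots of unity of an element that is within `ε`
of a finite sum of elements `s_μ s_ν^*`. -/
theorem norm_sum_gauge_le (hΛ : Λ.FinitelyAligned) (hB : Λ.ConditionB)
    (π : CStar.{u, w} Λ →⋆ₙₐ[ℂ] B) (hπ : ∀ v : Λ.Obj, π (gen Λ (Λ.vertex v)) ≠ 0)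
    {b : CStar.{u, w} Λ} (hb : π b = 0) {ε : ℝ} {J : Finset (Λ.Path × Λ.Path)}
    {c : Λ.Path × Λ.Path → ℂ} (hJ : ∀ p ∈ J, p.1.src = p.2.src)
    (hbJ : ‖b - ∑ p ∈ J, c p • (gen Λ p.1 * star (gen Λ p.2))‖ < ε) {N : ℕ} (hN : N ≠ 0)
    (hJN : ∀ p ∈ J, ∀ i, p.1.deg i < N ∧ p.2.deg i < N) :
    ‖∑ j ∈ Fintype.piFinset fun _ : Fin k => Finset.range N,
      gauge (fun i => Circle.exp (j i * (2 * Real.pi / N)))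
        (b : lp (fun i : CKFamily.{u, w} Λ => i.Alg) ∞)‖ ≤ (N : ℝ) ^ k * (2 * ε) := by
  classical
  set y : CStar.{u, w} Λ := ∑ p ∈ J, c p • (gen Λ p.1 * star (gen Λ p.2)) with hy
  set y₀ : CStar.{u, w} Λ := ∑ p ∈ J with p.1.deg = p.2.deg,
    c p • (gen Λ p.1 * star (gen Λ p.2)) with hy₀
  -- The diagonal part is bounded by $\|\pi(y)\|=\|\pi(b-y)\|$, because $\pi(b)=0$.
  have hy₀ε : ‖y₀‖ ≤ ε := by
    refine (norm_diagonal_le π hΛ hB (isCuntzKrieger_gen hΛ) hπ J hJ c).trans ?_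
    have h1 : π y = -π (b - y) := by rw [map_sub, hb, zero_sub, neg_neg]
    rw [← hy, h1, norm_neg]
    exact (NonUnitalStarAlgHom.norm_apply_le π _).trans hbJ.le
  have havg : ∑ j ∈ Fintype.piFinset fun _ : Fin k => Finset.range N,
      gauge (fun i => Circle.exp (j i * (2 * Real.pi / N)))
        (y : lp (fun i : CKFamily.{u, w} Λ => i.Alg) ∞) = ((N : ℂ) ^ k) • (y₀ : lp _ ∞) := by
    simp only [hy, gauge_sum]
    rw [Finset.sum_comm, hy₀, AddSubmonoidClass.coe_finsetSum, Finset.smul_sum, Finset.sum_filter]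
    refine Finset.sum_congr rfl fun p hp => ?_
    rw [← Finset.sum_smul, ← Finset.sum_mul, sum_phase_mul_star_phase hN
      (fun i => (hJN p hp i).1) fun i => (hJN p hp i).2]
    split_ifs
    · rw [mul_smul]
      rfl
    · rw [zero_mul, zero_smul]
  have hsplit : ∑ j ∈ Fintype.piFinset fun _ : Fin k => Finset.range N,
      gauge (fun i => Circle.exp (j i * (2 * Real.pi / N)))
        (b : lp (fun i : CKFamily.{u, w} Λ => i.Alg) ∞) =
      ∑ j ∈ Fintype.piFinset fun _ : Fin k => Finset.range N,
        gauge (fun i => Circle.exp (j i * (2 * Real.pi / N)))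
          ((b - y : CStar.{u, w} Λ) : lp (fun i : CKFamily.{u, w} Λ => i.Alg) ∞) +
      ((N : ℂ) ^ k) • (y₀ : lp _ ∞) := by
    rw [← havg, ← Finset.sum_add_distrib]
    refine Finset.sum_congr rfl fun j _ => ?_
    rw [← map_add, AddSubgroupClass.coe_sub, sub_add_cancel]
  have hcard : (Fintype.piFinset fun _ : Fin k => Finset.range N).card = N ^ k := by simp
  have h1 : ‖∑ j ∈ Fintype.piFinset fun _ : Fin k => Finset.range N,
        gauge (fun i => Circle.exp (j i * (2 * Real.pi / N)))
          ((b - y : CStar.{u, w} Λ) : lp (fun i : CKFamily.{u, w} Λ => i.Alg) ∞)‖ ≤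
      (N : ℝ) ^ k * ε := by
    refine (norm_sum_le_of_le _ fun j _ => (norm_gauge_le _ _).trans hbJ.le).trans ?_
    rw [Finset.sum_const, hcard, nsmul_eq_mul]
    push_cast
    exact le_rfl
  have h2 : ‖((N : ℂ) ^ k) • (y₀ : lp (fun i : CKFamily.{u, w} Λ => i.Alg) ∞)‖ ≤
      (N : ℝ) ^ k * ε := by
    rw [norm_smul, norm_pow, Complex.norm_natCast]
    exact mul_le_mul_of_nonneg_left hy₀ε (by positivity)
  rw [hsplit]
  exact (norm_add_le _ _).trans ((add_le_add h1 h2).trans_eq (by ring))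

theorem eq_zero_of_map_eq_zero (hΛ : Λ.FinitelyAligned) (hB : Λ.ConditionB)
    (π : CStar.{u, w} Λ →⋆ₙₐ[ℂ] B) (hπ : ∀ v : Λ.Obj, π (gen Λ (Λ.vertex v)) ≠ 0)
    {a : CStar.{u, w} Λ} (ha : π a = 0) : a = 0 := by
  -- The order is needed to bound a partial sum of translates of $b$ by the full sum.
  let _ : PartialOrder (lp (fun i : CKFamily.{u, w} Λ => i.Alg) ∞) := CStarAlgebra.spectralOrder _
  have _ : StarOrderedRing (lp (fun i : CKFamily.{u, w} Λ => i.Alg) ∞) :=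
    CStarAlgebra.spectralOrderedRing _
  set b : CStar.{u, w} Λ := star a * a with hbdef
  have hb : π b = 0 := by rw [hbdef, map_mul, ha, mul_zero]
  have hpos : ∀ z : Fin k → Circle,
      0 ≤ gauge z (b : lp (fun i : CKFamily.{u, w} Λ => i.Alg) ∞) := fun z =>
    gauge_star_mul_nonneg z (a : lp (fun i : CKFamily.{u, w} Λ => i.Alg) ∞)
  suffices H : ∀ ε > 0, ‖b‖ ≤ 0 + ε by
    have h1 : ‖b‖ = 0 := le_antisymm (le_of_forall_pos_le_add H) (norm_nonneg _)
    rw [hbdef, CStarRing.norm_star_mul_self] at h1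
    exact norm_eq_zero.1 (mul_self_eq_zero.1 h1)
  intro ε hε
  obtain ⟨δ, hδ, hcont⟩ := exists_norm_gauge_sub_le hΛ b (show 0 < ε / 2 by positivity)
  -- Angles below $2\pi/M$ move $b$ by at most $\varepsilon/2$. `M` is fixed before the
  -- approximation of $b$, so the tolerance there may depend on it.
  obtain ⟨M, hM⟩ := exists_nat_gt (2 * Real.pi / δ)
  have hM0 : (0 : ℝ) < M := lt_trans (by positivity) hM
  obtain ⟨J, c, hJ, hbJ⟩ := exists_norm_sub_sum_lt hΛ b
    (show 0 < ε / (4 * (M : ℝ) ^ k) by positivity)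
  obtain ⟨L, hL⟩ : ∃ L : ℕ, ∀ p ∈ J, ∀ i, p.1.deg i < L ∧ p.2.deg i < L := by
    refine ⟨(∑ p ∈ J, (p.1.size + p.2.size)) + 1, fun p hp i => ?_⟩
    have h1 : p.1.size + p.2.size ≤ ∑ p ∈ J, (p.1.size + p.2.size) :=
      Finset.single_le_sum (f := fun p : Λ.Path × Λ.Path => p.1.size + p.2.size)
        (fun _ _ => Nat.zero_le _) hp
    have h2 : p.1.deg i ≤ p.1.size :=
      Finset.single_le_sum (f := p.1.deg) (fun _ _ => Nat.zero_le _) (Finset.mem_univ i)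
    have h3 : p.2.deg i ≤ p.2.size :=
      Finset.single_le_sum (f := p.2.deg) (fun _ _ => Nat.zero_le _) (Finset.mem_univ i)
    omega
  have hM1 : 1 ≤ M := Nat.one_le_iff_ne_zero.2 (by rintro rfl; simp at hM0)
  -- Multi-indices with entries at most `L` give angles below $2\pi/M$; there are $(L+1)^k$ of them,
  -- the fraction $M^{-k}$ of all $N^k$. Also `N` exceeds every degree in `J`, as the averaging
  -- requires.
  set N := M * (L + 1) with hNdef
  have hLN : L + 1 ≤ N := Nat.le_mul_of_pos_left _ hM1
  have hall := norm_sum_gauge_le hΛ hB π hπ hb hJ hbJ (N := N) (by omega) fun p hp i =>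
    ⟨(hL p hp i).1.trans (by omega), (hL p hp i).2.trans (by omega)⟩
  have hsub : (Fintype.piFinset fun _ : Fin k => Finset.range (L + 1)) ⊆
      Fintype.piFinset fun _ : Fin k => Finset.range N :=
    Fintype.piFinset_subset _ _ fun _ => Finset.range_subset_range.2 hLN
  set f : (Fin k → ℕ) → lp (fun i : CKFamily.{u, w} Λ => i.Alg) ∞ := fun j =>
    gauge (fun i => Circle.exp (j i * (2 * Real.pi / N))) (b : lp _ ∞) with hf
  have hle : ‖∑ j ∈ Fintype.piFinset fun _ : Fin k => Finset.range (L + 1), f j‖ ≤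
      (N : ℝ) ^ k * (2 * (ε / (4 * (M : ℝ) ^ k))) := by
    refine (CStarAlgebra.norm_le_norm_of_nonneg_of_le (Finset.sum_nonneg fun j _ => hpos _)
      (Finset.sum_le_sum_of_subset_of_nonneg hsub fun j _ _ => hpos _)).trans hall
  have hclose : ∀ j ∈ Fintype.piFinset fun _ : Fin k => Finset.range (L + 1),
      ‖(b : lp (fun i : CKFamily.{u, w} Λ => i.Alg) ∞) - f j‖ ≤ ε / 2 := by
    intro j hj
    rw [norm_sub_rev]
    refine hcont (fun i => j i * (2 * Real.pi / N)) fun i => ?_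
    have h1 : j i < L + 1 := Finset.mem_range.1 (Fintype.mem_piFinset.1 hj i)
    have h2 : (j i : ℝ) < (L + 1 : ℕ) := by exact_mod_cast h1
    have h3 : (N : ℝ) = M * (L + 1 : ℕ) := by rw [hNdef, Nat.cast_mul]
    have h4 : (0 : ℝ) < (L + 1 : ℕ) := by positivity
    rw [abs_of_nonneg (by positivity), h3]
    calc (j i : ℝ) * (2 * Real.pi / (M * (L + 1 : ℕ)))
        ≤ (L + 1 : ℕ) * (2 * Real.pi / (M * (L + 1 : ℕ))) := by gcongr
      _ = 2 * Real.pi / M := by field_simp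
      _ < δ := by
        rw [div_lt_iff₀ hM0]
        rwa [div_lt_iff₀ hδ, mul_comm (M : ℝ)] at hM
  have hcard : (Fintype.piFinset fun _ : Fin k => Finset.range (L + 1)).card = (L + 1) ^ k := by
    simp
  have hsum : ((L + 1 : ℕ) : ℝ) ^ k * ‖b‖ ≤ (N : ℝ) ^ k * (2 * (ε / (4 * (M : ℝ) ^ k))) +
      ((L + 1 : ℕ) : ℝ) ^ k * (ε / 2) := by
    have h1 : ((L + 1) ^ k) • (b : lp (fun i : CKFamily.{u, w} Λ => i.Alg) ∞) =
        ∑ j ∈ Fintype.piFinset fun _ : Fin k => Finset.range (L + 1), f j +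
        ∑ j ∈ Fintype.piFinset fun _ : Fin k => Finset.range (L + 1), ((b : lp _ ∞) - f j) := by
      rw [← Finset.sum_add_distrib]
      simp only [add_sub_cancel]
      rw [Finset.sum_const, hcard]
    have h2 : ‖((L + 1) ^ k) • (b : lp (fun i : CKFamily.{u, w} Λ => i.Alg) ∞)‖ =
        ((L + 1 : ℕ) : ℝ) ^ k * ‖b‖ := by
      rw [← Nat.cast_smul_eq_nsmul ℝ, norm_smul, Real.norm_natCast, Nat.cast_pow]
      rfl
    rw [← h2, h1]
    refine (norm_add_le _ _).trans (add_le_add hle ((norm_sum_le_of_le _ hclose).trans ?_))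
    rw [Finset.sum_const, hcard, nsmul_eq_mul, Nat.cast_pow]
  have hL0 : (0 : ℝ) < ((L + 1 : ℕ) : ℝ) ^ k := by positivity
  -- The factor $M^k$ in $N^k$ cancels the one in the tolerance, which is why the tolerance was
  -- $\varepsilon/(4M^k)$.
  have hfin : (N : ℝ) ^ k * (2 * (ε / (4 * (M : ℝ) ^ k))) = ((L + 1 : ℕ) : ℝ) ^ k * (ε / 2) := by
    rw [hNdef, Nat.cast_mul, mul_pow]
    field_simp
    ring
  rw [hfin, ← mul_add, add_halves] at hsum
  rw [zero_add]
  exact le_of_mul_le_mul_left hsum hL0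

end Injectivity

end KGraph

/-- If `Λ` is a finitely aligned `k`-graph satisfying the aperiodicity condition (B), then every
homomorphism of `C*(Λ)` that does not vanish at any `s_v` is injective. -/
theorem theorem4p5 {k : ℕ} (Λ : KGraph.{u} k) (hΛ : Λ.FinitelyAligned) (hB : Λ.ConditionB)
    {B : Type v} [NonUnitalCStarAlgebra B] (π : KGraph.CStar.{u, w} Λ →⋆ₙₐ[ℂ] B)
    (hπ : ∀ a : Λ.Obj, π (KGraph.gen Λ (Λ.vertex a)) ≠ 0) :
    Function.Injective π :=
  (injective_iff_map_eq_zero π).2 fun _ ha => KGraph.eq_zero_of_map_eq_zero hΛ hB π hπ ha
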